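/- Let $Q$ be a finitely generated commutative monoid (written additively), $k$ a field, and $I\subseteq k[Q]$ a binomial ideal, i.e. an ideal generated by elements $t^p-\lambda t^q$ with $p,q\in Q$ and $\lambda\in k$ (possibly $\lambda=0$). Conventions. For any ideal $J\subseteq k[Q]$ write $p\sim_J q$ if $t^p-\lambda t^q\in J$ for some $\lambda\in k^*$; this is a congruence on $Q$. A nil of a monoid is an absorbing element; the one-element monoid, being a group, is considered to have no nil. An element is nilpotent if one of its multiples is nil, cancellative if adding it is injective, and partly cancellative if $x+a=x+b$ not nil implies $a=b$ for cancellative $a,b$. Green's preorder is $x\preceq y\iff y\in x+M$. A prime $P\subset Q$ is a proper, possibly empty, prime ideal of $Q$; $Q_P$ is the localization inverting $Q\setminus P$, $G_P$ is its unit group, $k[Q]_P=k[Q_P]$, $J_P=J\,k[Q]_P$, $\mathfrak m_P=\langle t^p\mid p\in P\rangle\subseteq k[Q]_P$, and for a congruence $\sim$ on $Q$, $\overline Q_P$ is the quotient of $Q_P$ by the congruence induced by $\sim$. A congruence is mesoprimary if every element of $\overline Q=Q/{\sim}$ is nilpotent or cancellative and every element is partly cancellative; it is $P$-mesoprimary if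 moreover $P$ is the set of elements of $Q$ with nilpotent image. It is coprincipal if it is $P$-mesoprimary for some $P$ and the set of non-nil elements of $\overline Q_P$ that are taken to nil by every nonunit is exactly one class of Green's relation. A binomial ideal is mesoprimary, $P$-mesoprimary or coprincipal if it is maximal among the proper binomial ideals inducing its congruence and that congruence is mesoprimary, $P$-mesoprimary or coprincipal, respectively. Now take $\sim\,=\,\sim_I$. An element $w\in Q$ is an $I$-witness for $P$ if $t^w\notin I_P$, the image $\overline w\in\overline Q_P$ is not nil, and for every $p\in P$ there is $b\in\overline Q_P$ with $b\neq\overline w$ and $\overline p+b=\overline p+\overline w$. (For $P=\varnothing$ this says that $I$ contains no monomial.) The $P$-mesoprime of $I$ at $w$ is the preimage in $k[Q]$ of $(I_P:t^w)+\mathfrak m_P$. Let $K_w\subseteq G_P$ be the stabilizer of $\overline w$. The character of $I_P$ at $w$ is the homomorphism $\rho:K_w\to k^*$ with $I_\rho+\mathfrak m_P=(I_P:t^w)+\mathfrak m_P$, where $I_\rho=\langle t^u-\rho(u-v)t^v\mid u-v\in K_w\rangle\subseteq k[Q]_P$, if there is one. For an $I$-witness $w$ for $P$ that has a character $\rho$,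 the coprincipal component $W_w^P(I)$ of $I$ cogenerated by $w$ at $P$ is the preimage in $k[Q]$ of $I_P+I_\rho+M\,k[Q]_P$, where $M\subseteq k[Q]$ is generated by the monomials $t^u$ with $\overline u\not\preceq\overline w$ in $\overline Q_P$. Theorem. (1) If $w$ is an $I$-witness for $P$ and $\overline p+\overline w\not\preceq\overline w$ in $\overline Q_P$ for all $p\in P$, then there is exactly one character of $I_P$ at $w$. (2) Every coprincipal component $W_w^P(I)$ cogenerated by an $I$-witness $w$ for a prime $P$ is a coprincipal, $P$-mesoprimary binomial ideal. (3) $I$ is the intersection of the coprincipal components $W_w^P(I)$ cogenerated by its witnesses, over all primes $P$ and all $I$-witnesses $w$ for $P$ that have a character. (4) Consequently $I$ has a combinatorial mesoprimary decomposition: $I$ is the intersection of a finite set of mesoprimary ideals $J$, which can be chosen among the components in (3), such that whenever $J$ is $P$-mesoprimary and $t^q$ is a monomial in the $P$-socle modulo $J$ (that is, $t^q\notin J_P$ and $\mathfrak m_P t^q\subseteq J_P$), the element $q$ is an $I$-witness for $P$ and the $P$-mesoprimes of $I$ and of $J$ at $q$ coincide. -/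

import Mathlib

namespace BinomialDecomposition

/-! ### Commutative monoids, written additively -/

section Monoid

variable {M : Type*} [AddCommMonoid M]

/-- A nil is an absorbing element. By convention the one-element monoid, being a group, has no nil;
in every other monoid this is the usual notion. -/
def IsNil (x : M) : Prop := (∃ y : M, y ≠ x) ∧ ∀ y : M, y + x = x

/-- Some multiple is nil. -/
def IsNilpotentElt (x : M) : Prop := ∃ n : ℕ, IsNil (n • x)

/-- Addition of `x` is injective. -/
def IsCancellative (x : M) : Prop := ∀ a b : M, x + a = x + b → a = b

/-- `x + a = x + b`, not nil, forces `a = b` for cancellative `a`, `b`. -/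
def IsPartlyCancellative (x : M) : Prop :=
  ∀ a b : M, IsCancellative a → IsCancellative b → x + a = x + b → ¬ IsNil (x + a) → a = b

/-- Green's preorder (divisibility): the ideal of `x` contains the ideal of `y`. -/
def GreenLE (x y : M) : Prop := ∃ u : M, x + u = y

/-- The socle: the non-nil elements that every nonunit takes to nil. -/
def socle (M : Type*) [AddCommMonoid M] : Set M :=
  {s | ¬ IsNil s ∧ ∀ a : M, ¬ IsAddUnit a → IsNil (s + a)}

/-- A (proper) prime ideal of a commutative monoid; it may be empty. -/
structure MonoidPrime (Q : Type*) [AddCommMonoid Q] where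
  /-- The underlying set. -/
  carrier : Set Q
  zero_notMem : (0 : Q) ∉ carrier
  add_mem : ∀ p ∈ carrier, ∀ q : Q, p + q ∈ carrier
  mem_or_mem : ∀ a b : Q, a + b ∈ carrier → a ∈ carrier ∨ b ∈ carrier

variable {Q : Type*} [AddCommMonoid Q]

/-- The complement of a prime ideal, a submonoid. -/
def MonoidPrime.face (P : MonoidPrime Q) : AddSubmonoid Q where
  carrier := P.carrierᶜ
  zero_mem' := P.zero_notMem
  add_mem' := fun ha hb h => (P.mem_or_mem _ _ h).elim ha hb

/-- The localization `Q_P`. -/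
abbrev MonoidPrime.Loc (P : MonoidPrime Q) : Type _ := AddLocalization P.face

/-- The canonical homomorphism `Q → Q_P`. -/
def MonoidPrime.toLoc (P : MonoidPrime Q) : Q →+ P.Loc :=
  (AddLocalization.addMonoidOf P.face).toAddMonoidHom

/-- The congruence on `Q_P` induced by (that is, generated by the image of) a congruence on `Q`. -/
def locCon (c : AddCon Q) (P : MonoidPrime Q) : AddCon P.Loc :=
  c.mapGen P.toLoc

/-- The localized quotient `Q_P / c`. -/
abbrev LocQuot (c : AddCon Q) (P : MonoidPrime Q) : Type _ := (locCon c P).Quotient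

/-- The map from `Q` to the localized quotient. -/
def toLocQuot (c : AddCon Q) (P : MonoidPrime Q) : Q →+ LocQuot c P :=
  (locCon c P).mk'.comp P.toLoc

/-- A congruence is mesoprimary if every element of the quotient is nilpotent or cancellative, and
every element is partly cancellative. -/
def IsMesoprimaryCon (c : AddCon Q) : Prop :=
  (∀ x : c.Quotient, IsNilpotentElt x ∨ IsCancellative x) ∧
    ∀ x : c.Quotient, IsPartlyCancellative x

/-- The elements whose class is nilpotent. -/
def nilpotentIdeal (c : AddCon Q) : Set Q := {q | IsNilpotentElt (q : c.Quotient)}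

/-- `c` is `P`-mesoprimary: mesoprimary, with `P` as nilpotent ideal (its associated prime). -/
def IsMesoprimaryConFor (c : AddCon Q) (P : MonoidPrime Q) : Prop :=
  IsMesoprimaryCon c ∧ P.carrier = nilpotentIdeal c

/-- A congruence is coprincipal if it is `P`-mesoprimary for some prime `P` and the socle of the
localized quotient at `P` consists of exactly one class of Green's relation. -/
def IsCoprincipalCon (c : AddCon Q) : Prop :=
  ∃ P : MonoidPrime Q, IsMesoprimaryConFor c P ∧ (socle (LocQuot c P)).Nonempty ∧
    ∀ s ∈ socle (LocQuot c P), ∀ s' ∈ socle (LocQuot c P), GreenLE s s' ∧ GreenLE s' s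

/-- The order ideal of `Q` cogenerated by `w` at `P`: the elements whose image in the localized
quotient precedes that of `w` in Green's preorder. -/
def orderIdeal (c : AddCon Q) (P : MonoidPrime Q) (w : Q) : Set Q :=
  {a | GreenLE (toLocQuot c P a) (toLocQuot c P w)}

end Monoid

/-! ### Binomial ideals in monoid algebras -/

section Algebra

variable {k : Type*} [Field k] {Q : Type*} [AddCommMonoid Q]

/-- The monomial `t ^ q`. -/
noncomputable def mono (k : Type*) [Field k] {Q : Type*} [AddCommMonoid Q] (q : Q) :
    AddMonoidAlgebra k Q :=
  AddMonoidAlgebra.single q 1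

/-- An ideal generated by binomials `t ^ p - c t ^ q`; the scalar `c` may be zero. -/
def IsBinomial (I : Ideal (AddMonoidAlgebra k Q)) : Prop :=
  ∃ S : Set (AddMonoidAlgebra k Q),
    (∀ f ∈ S, ∃ (p q : Q) (c : k), f = mono k p - c • mono k q) ∧ I = Ideal.span S

/-- The congruence induced by an ideal: `p ~ q` if `t ^ p - c t ^ q` lies in `I` for some unit
`c` of `k`. -/
def inducedCon (I : Ideal (AddMonoidAlgebra k Q)) : AddCon Q where
  r p q := ∃ c : kˣ, mono k p - (c : k) • mono k q ∈ I
  iseqv :=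
    { refl := fun p => ⟨1, by simp⟩
      symm := by
        rintro p q ⟨c, hc⟩
        refine ⟨c⁻¹, ?_⟩
        have h := Submodule.smul_of_tower_mem I (-((c⁻¹ : kˣ) : k)) hc
        have e : (-((c⁻¹ : kˣ) : k)) • (mono k p - (c : k) • mono k q)
            = mono k q - ((c⁻¹ : kˣ) : k) • mono k p := by
          rw [smul_sub, smul_smul, neg_mul, Units.inv_mul, neg_smul, neg_smul, one_smul]
          abel
        rwa [e] at h
      trans := by
        rintro p q r ⟨c, hc⟩ ⟨d, hd⟩
        refine ⟨c * d, ?_⟩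
        have h := I.add_mem hc (Submodule.smul_of_tower_mem I (c : k) hd)
        have e : mono k p - (c : k) • mono k q + (c : k) • (mono k q - (d : k) • mono k r)
            = mono k p - ((c * d : kˣ) : k) • mono k r := by
          rw [smul_sub, smul_smul, Units.val_mul]
          abel
        rwa [e] at h }
  add' := by
    rintro p q r s ⟨c, hc⟩ ⟨d, hd⟩
    refine ⟨c * d, ?_⟩
    have h := I.add_mem (I.mul_mem_left (mono k r) hc) (I.mul_mem_left ((c : k) • mono k q) hd)
    have e : mono k r * (mono k p - (c : k) • mono k q)
        + (c : k) • mono k q * (mono k r - (d : k) • mono k s)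
        = mono k (p + r) - ((c * d : kˣ) : k) • mono k (q + s) := by
      have m : ∀ a b : Q, mono k (a + b) = mono k a * mono k b := by
        intro a b
        simp [mono, AddMonoidAlgebra.single_mul_single]
      rw [m p r, m q s, Units.val_mul]
      simp only [Algebra.smul_def, map_mul]
      ring
    rwa [e] at h

/-- `I` is maximal among the proper binomial ideals that induce the same congruence as `I`. -/
def IsMaximalForCon (I : Ideal (AddMonoidAlgebra k Q)) : Prop :=
  Maximal (fun J : Ideal (AddMonoidAlgebra k Q) =>
    IsBinomial J ∧ J ≠ ⊤ ∧ inducedCon J = inducedCon I) I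

/-- A mesoprimary binomial ideal: maximal among the proper binomial ideals inducing a given
mesoprimary congruence. -/
def IsMesoprimary (I : Ideal (AddMonoidAlgebra k Q)) : Prop :=
  IsMaximalForCon I ∧ IsMesoprimaryCon (inducedCon I)

/-- A `P`-mesoprimary binomial ideal. -/
def IsMesoprimaryFor (I : Ideal (AddMonoidAlgebra k Q)) (P : MonoidPrime Q) : Prop :=
  IsMaximalForCon I ∧ IsMesoprimaryConFor (inducedCon I) P

/-- A coprincipal binomial ideal: maximal among the proper binomial ideals inducing a given
coprincipal congruence. -/
def IsCoprincipal (I : Ideal (AddMonoidAlgebra k Q)) : Prop :=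
  IsMaximalForCon I ∧ IsCoprincipalCon (inducedCon I)

/-- The map from `k[Q]` to its monomial localization `k[Q]_P = k[Q_P]`. -/
noncomputable def locMap (k : Type*) [Field k] {Q : Type*} [AddCommMonoid Q]
    (P : MonoidPrime Q) : AddMonoidAlgebra k Q →+* AddMonoidAlgebra k P.Loc :=
  AddMonoidAlgebra.mapDomainRingHom k P.toLoc

/-- The localization `I_P` of an ideal, an ideal of `k[Q_P]`. -/
noncomputable def locIdeal (I : Ideal (AddMonoidAlgebra k Q)) (P : MonoidPrime Q) :
    Ideal (AddMonoidAlgebra k P.Loc) :=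
  I.map (locMap k P)

/-- The monomial ideal `m_P` of `k[Q_P]`, generated by the `t ^ p` with `p ∈ P`. -/
noncomputable def primeMonomialIdeal (k : Type*) [Field k] {Q : Type*} [AddCommMonoid Q]
    (P : MonoidPrime Q) : Ideal (AddMonoidAlgebra k P.Loc) :=
  Ideal.span ((fun p : Q => mono k (P.toLoc p)) '' P.carrier)

/-- `w` is an `I`-witness for `P`: its image in the localized quotient is not nil, and for each
`p ∈ P` it is joined to some other element by the addition of `p`. For `P ≠ ∅` the first condition
follows from the other two; for `P = ∅` the definition says that `I` contains no monomial. -/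
def IsWitness (I : Ideal (AddMonoidAlgebra k Q)) (P : MonoidPrime Q) (w : Q) : Prop :=
  mono k (P.toLoc w) ∉ locIdeal I P ∧
  ¬ IsNil (toLocQuot (inducedCon I) P w) ∧
  ∀ p ∈ P.carrier, ∃ b : LocQuot (inducedCon I) P,
    b ≠ toLocQuot (inducedCon I) P w ∧
      toLocQuot (inducedCon I) P p + b
        = toLocQuot (inducedCon I) P p + toLocQuot (inducedCon I) P w

/-- The stabilizer of the class of `w` in the unit group `G_P` of `Q_P`. -/
def stabilizer (I : Ideal (AddMonoidAlgebra k Q)) (P : MonoidPrime Q) (w : Q) :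
    AddSubgroup (AddUnits P.Loc) where
  carrier := {g | (locCon (inducedCon I) P) ((g : P.Loc) + P.toLoc w) (P.toLoc w)}
  zero_mem' := by
    simpa using (locCon (inducedCon I) P).refl (P.toLoc w)
  add_mem' := by
    intro g h hg hh
    have h1 := (locCon (inducedCon I) P).add ((locCon (inducedCon I) P).refl (g : P.Loc)) hh
    have h2 := (locCon (inducedCon I) P).trans h1 hg
    simpa [add_assoc] using h2
  neg_mem' := by
    intro g hg
    have h1 := (locCon (inducedCon I) P).add
      ((locCon (inducedCon I) P).refl ((-g : AddUnits P.Loc) : P.Loc)) hg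
    rw [← add_assoc, AddUnits.neg_add, zero_add] at h1
    exact (locCon (inducedCon I) P).symm h1

/-- The ideal of `k[Q_P]` of a character `ρ : K → k*` on a subgroup `K` of `G_P`, generated by the
binomials `t ^ u - ρ (u - v) t ^ v` with `u - v ∈ K`. -/
noncomputable def characterIdeal {P : MonoidPrime Q} {K : AddSubgroup (AddUnits P.Loc)}
    (ρ : Multiplicative K →* kˣ) : Ideal (AddMonoidAlgebra k P.Loc) :=
  Ideal.span {f | ∃ (g : K) (v : P.Loc),
    f = mono k (((g : AddUnits P.Loc) : P.Loc) + v)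
      - ((ρ (Multiplicative.ofAdd g) : kˣ) : k) • mono k v}

/-- The ideal `(I_P : t ^ q) + m_P` of `k[Q_P]`. -/
noncomputable def localMesoprimeAt (I : Ideal (AddMonoidAlgebra k Q)) (P : MonoidPrime Q) (q : Q) :
    Ideal (AddMonoidAlgebra k P.Loc) :=
  (locIdeal I P).colon {mono k (P.toLoc q)} ⊔ primeMonomialIdeal k P

/-- The `P`-mesoprime of `I` at `q`: the preimage in `k[Q]` of `(I_P : t ^ q) + m_P`. -/
noncomputable def mesoprimeAt (I : Ideal (AddMonoidAlgebra k Q)) (P : MonoidPrime Q) (q : Q) :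
    Ideal (AddMonoidAlgebra k Q) :=
  (localMesoprimeAt I P q).comap (locMap k P)

/-- `ρ` is the character of `I_P` at `w`: its domain is the stabilizer of `w`, and
`I_ρ + m_P = (I_P : t ^ w) + m_P`. -/
def IsCharacterAt (I : Ideal (AddMonoidAlgebra k Q)) (P : MonoidPrime Q) (w : Q)
    (ρ : Multiplicative (stabilizer I P w) →* kˣ) : Prop :=
  characterIdeal ρ ⊔ primeMonomialIdeal k P = localMesoprimeAt I P w

/-- The monomial ideal of `k[Q]` cogenerated by `w` along `P`, generated by the monomials outside
of the order ideal cogenerated by `w` at `P`. -/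
noncomputable def cogeneratedMonomialIdeal (I : Ideal (AddMonoidAlgebra k Q)) (P : MonoidPrime Q)
    (w : Q) : Ideal (AddMonoidAlgebra k Q) :=
  Ideal.span ((fun u : Q => mono k u) '' (orderIdeal (inducedCon I) P w)ᶜ)

/-- The component of `I` cogenerated by `w` along `P`, for the character `ρ` of `I_P` at `w`: the
preimage in `k[Q]` of the sum of `I_P`, the ideal of `ρ`, and the monomial ideal cogenerated
by `w`. -/
noncomputable def component (I : Ideal (AddMonoidAlgebra k Q)) (P : MonoidPrime Q) (w : Q)
    (ρ : Multiplicative (stabilizer I P w) →* kˣ) : Ideal (AddMonoidAlgebra k Q) :=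
  (locIdeal I P ⊔ characterIdeal ρ ⊔ (cogeneratedMonomialIdeal I P w).map (locMap k P)).comap
    (locMap k P)

/-- `J` is the coprincipal component of `I` cogenerated at `P` by some `I`-witness for `P`. -/
def IsCoprincipalComponent (I : Ideal (AddMonoidAlgebra k Q)) (P : MonoidPrime Q)
    (J : Ideal (AddMonoidAlgebra k Q)) : Prop :=
  ∃ (w : Q) (ρ : Multiplicative (stabilizer I P w) →* kˣ),
    IsWitness I P w ∧ IsCharacterAt I P w ρ ∧ J = component I P w ρ

/-- The monomial `t ^ q` lies in the `P`-socle modulo `J`: it is nonzero in `k[Q]_P / J_P` and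
annihilated there by `m_P`. -/
def InMonomialSocle (J : Ideal (AddMonoidAlgebra k Q)) (P : MonoidPrime Q) (q : Q) : Prop :=
  mono k (P.toLoc q) ∉ locIdeal J P ∧ ∀ p ∈ P.carrier, mono k (P.toLoc (p + q)) ∈ locIdeal J P

/-- A mesoprimary decomposition of `I`: finitely many mesoprimary ideals with intersection `I`
such that, for each `P`-mesoprimary `J` among them, the `P`-mesoprimes of `I` and `J` agree at every
socle monomial of `J` along `P`. -/
def IsMesoprimaryDecomposition (I : Ideal (AddMonoidAlgebra k Q))
    (𝒥 : Set (Ideal (AddMonoidAlgebra k Q))) : Prop :=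
  𝒥.Finite ∧ I = sInf 𝒥 ∧ (∀ J ∈ 𝒥, IsMesoprimary J) ∧
    ∀ J ∈ 𝒥, ∀ P : MonoidPrime Q, IsMesoprimaryFor J P → ∀ q : Q, InMonomialSocle J P q →
      mesoprimeAt I P q = mesoprimeAt J P q

/-- A mesoprimary decomposition is combinatorial if the socle monomials of every component are
`I`-witnesses. -/
def IsCombinatorialDecomposition (I : Ideal (AddMonoidAlgebra k Q))
    (𝒥 : Set (Ideal (AddMonoidAlgebra k Q))) : Prop :=
  IsMesoprimaryDecomposition I 𝒥 ∧
    ∀ J ∈ 𝒥, ∀ P : MonoidPrime Q, IsMesoprimaryFor J P → ∀ q : Q, InMonomialSocle J P q →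
      IsWitness I P q

end Algebra

end BinomialDecomposition

/-
Modulo a binomial ideal, monomials in distinct classes of the induced congruence are linearly
independent, so ideals can be compared by functionals that read off the coordinate along a class.

Let `f ∉ I`. Among the nonzero monomial multiples of `f` modulo `I` choose one whose annihilator is
maximal: the monomials that kill it form a prime `P`, so it lies in the socle of `k[Q]_P / I_P` and
is not zero there. Write its image in terms of pairwise inequivalent monomials and let `t^w` be one
that is minimal for Green's preorder. Minimality makes the stabilizer of `w` consist of units, and
each nonunit either kills `t^w` or makes it equivalent to another monomial of the sum; hence `w` is
a witness with a character. The coordinate along `t^w` vanishes on the component at `w` but not on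
`f`, so `f` is not in that component. The socle is generated by finitely many elements, and `w` is a
unit translate of a monomial occurring in one of them; together with the finiteness of the set of
primes this bounds the number of components.

In `k[Q]_P`, the component at `w` is cogenerated by the single class of `t^w`, and all the
properties of a coprincipal ideal follow from that.
-/

namespace BinomialDecomposition

open scoped AddMonoidAlgebra

section Monomials

variable {k : Type*} [Field k] {S S' : Type*} [AddCommMonoid S] [AddCommMonoid S']

theorem mono_add (a b : S) : mono k (a + b) = mono k a * mono k b := by
  simp [mono, AddMonoidAlgebra.single_mul_single]

theorem mono_zero : mono k (0 : S) = 1 := rfl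

theorem coeff_mono [DecidableEq S] (u v : S) : (mono k u).coeff v = if u = v then 1 else 0 := by
  rw [mono, AddMonoidAlgebra.coeff_single, Finsupp.single_apply]

theorem eq_sum_smul_mono (f : k[S]) : f = ∑ u ∈ f.coeff.support, f.coeff u • mono k u :=
  ((AddMonoidAlgebra.basis S k).linearCombination_repr f).symm

theorem linearMap_ext_mono {E : Type*} [AddCommGroup E] [Module k E] {φ ψ : k[S] →ₗ[k] E}
    (h : ∀ u, φ (mono k u) = ψ (mono k u)) : φ = ψ :=
  (AddMonoidAlgebra.basis S k).ext h

/-- The linear map on the monoid algebra with prescribed values on the monomials. -/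
noncomputable def linearExtension {E : Type*} [AddCommGroup E] [Module k E] (χ : S → E) :
    k[S] →ₗ[k] E :=
  (AddMonoidAlgebra.basis S k).constr k χ

@[simp]
theorem linearExtension_mono {E : Type*} [AddCommGroup E] [Module k E] (χ : S → E) (u : S) :
    linearExtension (k := k) χ (mono k u) = χ u :=
  (AddMonoidAlgebra.basis S k).constr_basis k χ u

theorem mapDomainLinearMap_mono (h : S → S') (u : S) :
    AddMonoidAlgebra.mapDomainLinearMap k k h (mono k u) = mono k (h u) :=
  AddMonoidAlgebra.mapDomainLinearMap_single h 1 u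

theorem mono_mul_eq_mapDomainLinearMap (x : S) (f : k[S]) :
    mono k x * f = AddMonoidAlgebra.mapDomainLinearMap k k (x + ·) f := by
  suffices LinearMap.mulLeft k (mono k x) = AddMonoidAlgebra.mapDomainLinearMap k k (x + ·) from
    DFunLike.congr_fun this f
  refine linearMap_ext_mono fun u => ?_
  rw [LinearMap.mulLeft_apply, mapDomainLinearMap_mono, mono_add]

theorem map_eq_of_forall_ne {E : Type*} [AddCommGroup E] [Module k E] (φ : k[S] →ₗ[k] E)
    (f : k[S]) (u : S) (h : ∀ v ∈ f.coeff.support, v ≠ u → φ (mono k v) = 0) :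
    φ f = f.coeff u • φ (mono k u) := by
  conv_lhs => rw [eq_sum_smul_mono f, map_sum]
  rw [Finset.sum_eq_single u, map_smul]
  · intro v hv hne
    rw [map_smul, h v hv hne, smul_zero]
  · intro hu
    rw [Finsupp.notMem_support_iff.1 hu, zero_smul, map_zero]

theorem exists_map_mono_ne_zero {E : Type*} [AddCommGroup E] [Module k E] (φ : k[S] →ₗ[k] E)
    {f : k[S]} (hf : φ f ≠ 0) : ∃ u ∈ f.coeff.support, φ (mono k u) ≠ 0 := by
  contrapose! hf
  rw [eq_sum_smul_mono f, map_sum]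
  exact Finset.sum_eq_zero fun u hu => by rw [map_smul, hf u hu, smul_zero]

theorem map_eq_zero_of_mem_span {E : Type*} [AddCommGroup E] [Module k E] (φ : k[S] →ₗ[k] E)
    {T : Set k[S]} (hT : ∀ a, ∀ f ∈ T, φ (mono k a * f) = 0) {f : k[S]} (hf : f ∈ Ideal.span T) :
    φ f = 0 := by
  suffices ∀ r : k[S], φ (r * f) = 0 by simpa only [one_mul] using this 1
  induction hf using Submodule.span_induction with
  | mem f hf =>
    have h : φ ∘ₗ LinearMap.mulRight k f = 0 := linearMap_ext_mono fun a => hT a f hf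
    exact DFunLike.congr_fun h
  | zero => simp only [mul_zero, map_zero, implies_true]
  | add f g _ _ hf hg => intro r; rw [mul_add, map_add, hf, hg, add_zero]
  | smul a f _ hf => intro r; rw [smul_eq_mul, ← mul_assoc, hf]

theorem mono_mul_binomial (a p q : S) (c : k) :
    mono k a * (mono k p - c • mono k q) = mono k (a + p) - c • mono k (a + q) := by
  rw [mul_sub, mul_smul_comm, mono_add, mono_add]

end Monomials

section InducedCon

variable {k : Type*} [Field k] {S : Type*} [AddCommMonoid S] {J J' : Ideal k[S]}

theorem smul_mem_ideal_iff {r : k} (hr : r ≠ 0) {f : k[S]} : r • f ∈ J ↔ f ∈ J :=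
  Submodule.smul_mem_iff (J.restrictScalars k) hr

theorem mono_mem_iff_of_sub_mem {p q : S} {c : k} (hc : c ≠ 0)
    (h : mono k p - c • mono k q ∈ J) : mono k p ∈ J ↔ mono k q ∈ J := by
  rw [← smul_mem_ideal_iff (J := J) hc (f := mono k q)]
  exact ⟨fun hp => (Submodule.sub_mem_iff_right J hp).1 h,
    fun hq => (Submodule.sub_mem_iff_left J hq).1 h⟩

theorem mono_mem_iff_of_inducedCon {p q : S} (h : inducedCon J p q) :
    mono k p ∈ J ↔ mono k q ∈ J := by
  obtain ⟨c, hc⟩ := h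
  exact mono_mem_iff_of_sub_mem c.ne_zero hc

theorem inducedCon_of_mono_mem {p q : S} (hp : mono k p ∈ J) (hq : mono k q ∈ J) :
    inducedCon J p q :=
  ⟨1, J.sub_mem hp (Submodule.smul_of_tower_mem J _ hq)⟩

theorem inducedCon_mono (h : J ≤ J') : inducedCon J ≤ inducedCon J' :=
  fun _ _ ⟨c, hc⟩ => ⟨c, h hc⟩

theorem inducedCon_add_left {p q : S} (a : S) (h : inducedCon J p q) :
    inducedCon J (a + p) (a + q) :=
  (inducedCon J).add ((inducedCon J).refl a) h

theorem mono_add_mem (a : S) {p : S} (hp : mono k p ∈ J) : mono k (a + p) ∈ J := by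
  rw [mono_add]
  exact J.mul_mem_left _ hp

theorem isUnit_mono {g : S} (hg : IsAddUnit g) : IsUnit (mono k g) := by
  obtain ⟨g, rfl⟩ := hg
  refine IsUnit.of_mul_eq_one (mono k ((-g : AddUnits S) : S)) ?_
  rw [← mono_add, AddUnits.add_neg, mono_zero]

theorem mono_mul_mem_iff {g : S} (hg : IsAddUnit g) {f : k[S]} : mono k g * f ∈ J ↔ f ∈ J :=
  Ideal.unit_mul_mem_iff_mem J (isUnit_mono hg)

theorem mono_add_mem_iff {g p : S} (hg : IsAddUnit g) : mono k (g + p) ∈ J ↔ mono k p ∈ J := by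
  rw [mono_add, mono_mul_mem_iff hg]

theorem scalar_unique {u w : S} (hw : mono k w ∉ J) {c d : k} (hc : mono k u - c • mono k w ∈ J)
    (hd : mono k u - d • mono k w ∈ J) : c = d := by
  by_contra hne
  apply hw
  rw [← smul_mem_ideal_iff (sub_ne_zero.2 hne), sub_smul, ← sub_sub_sub_cancel_left]
  exact J.sub_mem hd hc

end InducedCon

section BinomialIdeals

variable {k : Type*} [Field k] {S S' : Type*} [AddCommMonoid S] [AddCommMonoid S']
  {I J L : Ideal k[S]}

theorem exists_class_coordinate {w : S} (hw : mono k w ∉ J) (u : S) :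
    ∃ d : k, (∀ c : kˣ, mono k u - (c : k) • mono k w ∈ J → d = c) ∧
      (¬ inducedCon J u w → d = 0) := by
  by_cases h : inducedCon J u w
  · obtain ⟨c, hc⟩ := h
    exact ⟨c, fun d hd => scalar_unique hw hc hd, fun h => (h ⟨c, hc⟩).elim⟩
  · exact ⟨0, fun c hc => (h ⟨c, hc⟩).elim, fun _ => rfl⟩

/- Monomials in distinct classes are linearly independent modulo a binomial ideal: the functional
reads off the coordinate along `t ^ w`. -/
theorem IsBinomial.exists_functional (hJ : IsBinomial J) {w : S} (hw : mono k w ∉ J) :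
    ∃ φ : k[S] →ₗ[k] k, (∀ f ∈ J, φ f = 0) ∧ φ (mono k w) = 1 ∧
      ∀ u, ¬ inducedCon J u w → φ (mono k u) = 0 := by
  choose χ hχ hχ0 using exists_class_coordinate hw
  refine ⟨linearExtension χ, ?_, ?_, fun u hu => ?_⟩
  · obtain ⟨T, hT, rfl⟩ := hJ
    refine fun f => map_eq_zero_of_mem_span _ fun a f hf => ?_
    obtain ⟨p, q, c, rfl⟩ := hT f hf
    have hmem := (Ideal.span T).mul_mem_left (mono k a) (Ideal.subset_span hf)
    rw [mono_mul_binomial] at hmem ⊢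
    rw [map_sub, map_smul, linearExtension_mono, linearExtension_mono, smul_eq_mul]
    rcases eq_or_ne c 0 with rfl | hc
    · rw [zero_smul, sub_zero] at hmem
      rw [zero_mul, sub_zero]
      exact hχ0 _ fun h => hw ((mono_mem_iff_of_inducedCon h).1 hmem)
    · by_cases hq : inducedCon (Ideal.span T) (a + q) w
      · obtain ⟨d, hd⟩ := hq
        have hpw : mono k (a + p) - ((Units.mk0 c hc * d : kˣ) : k) • mono k w ∈ Ideal.span T := by
          have := (Ideal.span T).add_mem hmem (Submodule.smul_of_tower_mem _ c hd)
          rwa [smul_sub, smul_smul, sub_add_sub_cancel] at this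
        rw [hχ _ d hd, hχ _ _ hpw, Units.val_mul, Units.val_mk0, sub_self]
      · have hp : ¬ inducedCon (Ideal.span T) (a + p) w := fun h =>
          hq ((inducedCon _).trans ((inducedCon _).symm ⟨Units.mk0 c hc, hmem⟩) h)
        rw [hχ0 _ hq, hχ0 _ hp, mul_zero, sub_zero]
  · rw [linearExtension_mono]
    exact hχ w 1 (by simp)
  · rw [linearExtension_mono, hχ0 u hu]

theorem IsBinomial.mapDomainLinearMap_notMem {L : Ideal k[S']} (hL : IsBinomial L) (h : S → S')
    {g : k[S]} {w : S} (hw : w ∈ g.coeff.support) (hwL : mono k (h w) ∉ L)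
    (hcon : ∀ v ∈ g.coeff.support, inducedCon L (h v) (h w) → v = w) :
    AddMonoidAlgebra.mapDomainLinearMap k k h g ∉ L := by
  obtain ⟨φ, hφL, hφw, hφ⟩ := hL.exists_functional hwL
  intro hg
  have := map_eq_of_forall_ne (φ ∘ₗ AddMonoidAlgebra.mapDomainLinearMap k k h) g w
    fun v hv hvw => by
      rw [LinearMap.comp_apply, mapDomainLinearMap_mono, hφ _ (mt (hcon v hv) hvw)]
  rw [LinearMap.comp_apply, LinearMap.comp_apply, mapDomainLinearMap_mono, hφL _ hg, hφw,
    smul_eq_mul, mul_one] at this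
  exact Finsupp.mem_support_iff.1 hw this.symm

/-- The largest binomial ideal contained in an ideal. -/
noncomputable def binomialPart (J : Ideal k[S]) : Ideal k[S] :=
  Ideal.span {f | f ∈ J ∧ ∃ (p q : S) (c : k), f = mono k p - c • mono k q}

theorem binomialPart_le (J : Ideal k[S]) : binomialPart J ≤ J :=
  Ideal.span_le.2 fun _ hf => hf.1

theorem isBinomial_of_le_binomialPart (h : J ≤ binomialPart J) : IsBinomial J :=
  ⟨_, fun _ hf => hf.2, le_antisymm h (binomialPart_le J)⟩

/-- An element is reduced modulo `J` if its monomials lie outside of `J`, in pairwise distinct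
classes. By `exists_isReduced` such elements are normal forms modulo the binomials of `J`. -/
structure IsReduced (J : Ideal k[S]) (g : k[S]) : Prop where
  mono_notMem : ∀ u ∈ g.coeff.support, mono k u ∉ J
  eq_of_inducedCon : ∀ u ∈ g.coeff.support, ∀ v ∈ g.coeff.support, inducedCon J u v → u = v

theorem exists_binomial_of_not_isReduced {f : k[S]} (hf : ¬ IsReduced J f) :
    ∃ u ∈ f.coeff.support, ∃ (v : S) (c : k), (c = 0 ∨ v ∈ f.coeff.support ∧ v ≠ u) ∧
      mono k u - c • mono k v ∈ J := by
  contrapose! hf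
  refine ⟨fun u hu h => hf u hu u 0 (.inl rfl) (by rwa [zero_smul, sub_zero]), ?_⟩
  rintro u hu v hv ⟨c, hc⟩
  by_contra huv
  exact hf u hu v c (.inr ⟨hv, Ne.symm huv⟩) hc

theorem support_sub_smul_binomial_subset [DecidableEq S] (f : k[S]) {u v : S} {c : k}
    (h : c = 0 ∨ v ∈ f.coeff.support ∧ v ≠ u) :
    (f - f.coeff u • (mono k u - c • mono k v)).coeff.support ⊆ f.coeff.support.erase u := by
  intro x hx
  simp only [Finsupp.mem_support_iff, AddMonoidAlgebra.coeff_sub, AddMonoidAlgebra.coeff_smul,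
    Finsupp.sub_apply, Finsupp.smul_apply, coeff_mono, smul_eq_mul] at hx
  rw [Finset.mem_erase, Finsupp.mem_support_iff]
  grind

theorem exists_isReduced (J : Ideal k[S]) (f : k[S]) :
    ∃ g, f - g ∈ binomialPart J ∧ IsReduced J g := by
  classical
  induction hn : f.coeff.support.card using Nat.strong_induction_on generalizing f with
  | _ n ih =>
  by_cases hf : IsReduced J f
  · exact ⟨f, by simp, hf⟩
  obtain ⟨u, hu, v, c, hc, hmem⟩ := exists_binomial_of_not_isReduced hf
  set b := f.coeff u • (mono k u - c • mono k v)
  have hb : b ∈ binomialPart J :=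
    Submodule.smul_of_tower_mem _ _ (Ideal.subset_span ⟨hmem, u, v, c, rfl⟩)
  have hcard : (f - b).coeff.support.card < n := hn ▸
    (Finset.card_le_card (support_sub_smul_binomial_subset f hc)).trans_lt
      (Finset.card_erase_lt_of_mem hu)
  obtain ⟨g, hg, hred⟩ := ih _ hcard (f - b) rfl
  refine ⟨g, ?_, hred⟩
  simpa only [sub_right_comm, sub_add_cancel] using (binomialPart J).add_mem hg hb

theorem inducedCon_iff_of_mem_iff_mapDomain {J : Ideal k[S']} {h : S → S'}
    (hL : ∀ f, f ∈ L ↔ AddMonoidAlgebra.mapDomainLinearMap k k h f ∈ J) {u v : S} :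
    inducedCon L u v ↔ inducedCon J (h u) (h v) :=
  exists_congr fun c => by
    rw [hL, map_sub, map_smul, mapDomainLinearMap_mono, mapDomainLinearMap_mono]

theorem mono_mem_iff_of_mem_iff_mapDomain {J : Ideal k[S']} {h : S → S'}
    (hL : ∀ f, f ∈ L ↔ AddMonoidAlgebra.mapDomainLinearMap k k h f ∈ J) {u : S} :
    mono k u ∈ L ↔ mono k (h u) ∈ J := by
  rw [hL, mapDomainLinearMap_mono]

theorem isBinomial_of_mem_iff_mapDomain {J : Ideal k[S']} (hJ : IsBinomial J) {h : S → S'}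
    (hL : ∀ f, f ∈ L ↔ AddMonoidAlgebra.mapDomainLinearMap k k h f ∈ J) : IsBinomial L := by
  refine isBinomial_of_le_binomialPart fun f hf => ?_
  obtain ⟨g, hfg, hred⟩ := exists_isReduced L f
  have hgL : g ∈ L := (Submodule.sub_mem_iff_right L hf).1 (binomialPart_le L hfg)
  suffices hg : g = 0 by rwa [hg, sub_zero] at hfg
  by_contra hg
  obtain ⟨w, hw⟩ : g.coeff.support.Nonempty := by
    rw [Finsupp.support_nonempty_iff]
    simpa using hg
  refine hJ.mapDomainLinearMap_notMem h hw ?_ (fun v hv hvw => ?_) ((hL g).1 hgL)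
  · rw [← mono_mem_iff_of_mem_iff_mapDomain hL]
    exact hred.mono_notMem w hw
  · exact hred.eq_of_inducedCon v hv w hw ((inducedCon_iff_of_mem_iff_mapDomain hL).2 hvw)

theorem mem_colon_mono_iff {x : S} {f : k[S]} : f ∈ J.colon {mono k x} ↔ mono k x * f ∈ J := by
  rw [Submodule.mem_colon_singleton, smul_eq_mul, mul_comm]

theorem mem_colon_mono_iff_mapDomain (J : Ideal k[S]) (x : S) (f : k[S]) :
    f ∈ J.colon {mono k x} ↔ AddMonoidAlgebra.mapDomainLinearMap k k (x + ·) f ∈ J := by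
  rw [mem_colon_mono_iff, mono_mul_eq_mapDomainLinearMap]

theorem IsBinomial.colon_mono (hJ : IsBinomial J) (x : S) : IsBinomial (J.colon {mono k x}) :=
  isBinomial_of_mem_iff_mapDomain hJ (mem_colon_mono_iff_mapDomain J x)

theorem colon_mono_eq_of_inducedCon {x y : S} (h : inducedCon J x y) :
    J.colon {mono k x} = J.colon {mono k y} := by
  obtain ⟨c, hc⟩ := h
  ext f
  rw [mem_colon_mono_iff, mem_colon_mono_iff, ← smul_mem_ideal_iff c.ne_zero (f := mono k y * f)]
  have hmem := J.mul_mem_right f hc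
  rw [sub_mul, smul_mul_assoc] at hmem
  exact ⟨fun hx => (Submodule.sub_mem_iff_right J hx).1 hmem,
    fun hy => (Submodule.sub_mem_iff_left J hy).1 hmem⟩

theorem colon_mono_add_eq {g x : S} (hg : IsAddUnit g) :
    J.colon {mono k (g + x)} = J.colon {mono k x} := by
  ext f
  rw [mem_colon_mono_iff, mem_colon_mono_iff, mono_add, mul_assoc, mono_mul_mem_iff hg]

theorem IsBinomial.le_of_inducedCon_le (hJ : IsBinomial J) (hIJ : I ≤ J)
    (hmono : ∀ u, mono k u ∈ J → mono k u ∈ I) (hcon : inducedCon J ≤ inducedCon I) : J ≤ I := by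
  obtain ⟨T, hT, rfl⟩ := hJ
  refine Ideal.span_le.2 fun f hf => ?_
  obtain ⟨p, q, c, rfl⟩ := hT f hf
  have hmem : mono k p - c • mono k q ∈ Ideal.span T := Ideal.subset_span hf
  by_cases hq : mono k q ∈ Ideal.span T
  · have hp := (Submodule.sub_mem_iff_left _ (Submodule.smul_of_tower_mem _ c hq)).1 hmem
    exact I.sub_mem (hmono p hp) (Submodule.smul_of_tower_mem _ c (hmono q hq))
  rcases eq_or_ne c 0 with rfl | hc
  · rw [zero_smul, sub_zero] at hmem ⊢
    exact hmono p hmem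
  · obtain ⟨d, hd⟩ := hcon ⟨Units.mk0 c hc, hmem⟩
    rwa [SetLike.mem_coe, scalar_unique hq hmem (hIJ hd)]

theorem IsBinomial.sup (hI : IsBinomial I) (hJ : IsBinomial J) : IsBinomial (I ⊔ J) := by
  obtain ⟨A, hA, rfl⟩ := hI
  obtain ⟨B, hB, rfl⟩ := hJ
  exact ⟨A ∪ B, fun f hf => hf.elim (hA f) (hB f), (Ideal.span_union A B).symm⟩

theorem isBinomial_span_mono (A : Set S) : IsBinomial (Ideal.span (mono k '' A)) :=
  ⟨_, by rintro _ ⟨u, -, rfl⟩; exact ⟨u, u, 0, by simp⟩, rfl⟩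

theorem IsBinomial.map {R : Type*} [AddCommMonoid R] (hJ : IsBinomial J) (h : S →+ R) :
    IsBinomial (J.map (AddMonoidAlgebra.mapDomainRingHom k h)) := by
  obtain ⟨T, hT, rfl⟩ := hJ
  refine ⟨AddMonoidAlgebra.mapDomainRingHom k h '' T, ?_, Ideal.map_span _ _⟩
  rintro _ ⟨f, hf, rfl⟩
  obtain ⟨p, q, c, rfl⟩ := hT f hf
  exact ⟨h p, h q, c, (map_sub (AddMonoidAlgebra.mapDomainLinearMap k k h) _ _).trans (by
    rw [map_smul, mapDomainLinearMap_mono, mapDomainLinearMap_mono])⟩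

end BinomialIdeals

section Localization

variable {k : Type*} [Field k] {Q : Type*} [AddCommMonoid Q]

namespace MonoidPrime

variable (P : MonoidPrime Q)

theorem toLoc_surj (x : P.Loc) : ∃ q, ∃ s ∈ P.face, x + P.toLoc s = P.toLoc q := by
  obtain ⟨⟨q, s⟩, h⟩ := (AddLocalization.addMonoidOf P.face).surj x
  exact ⟨q, s, s.2, h⟩

theorem toLoc_eq_iff {a b : Q} : P.toLoc a = P.toLoc b ↔ ∃ s ∈ P.face, s + a = s + b := by
  refine (AddLocalization.addMonoidOf P.face).eq_iff_exists.trans ?_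
  exact ⟨fun ⟨s, h⟩ => ⟨s, s.2, h⟩, fun ⟨s, hs, h⟩ => ⟨⟨s, hs⟩, h⟩⟩

theorem isAddUnit_toLoc_of_mem_face {s : Q} (hs : s ∈ P.face) : IsAddUnit (P.toLoc s) :=
  (AddLocalization.addMonoidOf P.face).map_addUnits ⟨s, hs⟩

theorem isAddUnit_toLoc_iff {q : Q} : IsAddUnit (P.toLoc q) ↔ q ∉ P.carrier := by
  refine ⟨fun h hq => ?_, P.isAddUnit_toLoc_of_mem_face⟩
  obtain ⟨y, hy⟩ := h.exists_neg
  obtain ⟨b, s, hs, hb⟩ := P.toLoc_surj y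
  have hqb : P.toLoc (q + b) = P.toLoc s := by
    rw [map_add, ← hb, ← add_assoc, hy, zero_add]
  obtain ⟨t, ht, e⟩ := P.toLoc_eq_iff.1 hqb
  refine P.face.add_mem ht hs (e ▸ ?_)
  rw [add_left_comm]
  exact P.add_mem q hq _

theorem exists_isAddUnit_add_eq_toLoc (x : P.Loc) :
    ∃ g, IsAddUnit g ∧ ∃ q, g + x = P.toLoc q := by
  obtain ⟨q, s, hs, h⟩ := P.toLoc_surj x
  exact ⟨P.toLoc s, P.isAddUnit_toLoc_of_mem_face hs, q, by rw [add_comm, h]⟩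

theorem exists_mem_carrier_of_not_isAddUnit {x : P.Loc} (hx : ¬ IsAddUnit x) :
    ∃ g, IsAddUnit g ∧ ∃ p ∈ P.carrier, g + x = P.toLoc p := by
  obtain ⟨g, hg, p, hp⟩ := P.exists_isAddUnit_add_eq_toLoc x
  refine ⟨g, hg, p, by_contra fun hpP => hx ?_, hp⟩
  exact isAddUnit_of_add_isAddUnit_right (hp ▸ P.isAddUnit_toLoc_iff.2 hpP)

theorem not_isAddUnit_toLoc {p : Q} (hp : p ∈ P.carrier) : ¬ IsAddUnit (P.toLoc p) :=
  fun h => P.isAddUnit_toLoc_iff.1 h hp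

/-- The monomials inverted by the localization at `P`. -/
noncomputable def faceMonomials (k : Type*) [Field k] : Submonoid k[Q] :=
  (AddSubmonoid.toSubmonoid P.face).map (AddMonoidAlgebra.of k Q)

end MonoidPrime

variable {P : MonoidPrime Q}

theorem locMap_apply (f : k[Q]) :
    locMap k P f = AddMonoidAlgebra.mapDomainLinearMap k k P.toLoc f := rfl

theorem locMap_mono (q : Q) : locMap k P (mono k q) = mono k (P.toLoc q) :=
  mapDomainLinearMap_mono _ _

theorem locMap_smul (c : k) (f : k[Q]) : locMap k P (c • f) = c • locMap k P f :=
  map_smul (AddMonoidAlgebra.mapDomainLinearMap k k P.toLoc) c f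

theorem locMap_binomial (p q : Q) (c : k) :
    locMap k P (mono k p - c • mono k q) = mono k (P.toLoc p) - c • mono k (P.toLoc q) := by
  rw [map_sub, locMap_smul, locMap_mono, locMap_mono]

theorem exists_mono_mul_eq_locMap (g : k[P.Loc]) :
    ∃ s ∈ P.face, ∃ f, mono k (P.toLoc s) * g = locMap k P f := by
  induction g using AddMonoidAlgebra.induction_linear with
  | zero => exact ⟨0, P.face.zero_mem, 0, by simp⟩
  | add g h hg hh =>
    obtain ⟨s, hs, f, hf⟩ := hg
    obtain ⟨t, ht, e, he⟩ := hh
    refine ⟨s + t, P.face.add_mem hs ht, mono k t * f + mono k s * e, ?_⟩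
    rw [map_add, map_add, map_mul, map_mul, ← hf, ← he, locMap_mono, locMap_mono, mono_add]
    ring
  | single u r =>
    obtain ⟨q, s, hs, h⟩ := P.toLoc_surj u
    refine ⟨s, hs, AddMonoidAlgebra.single q r, ?_⟩
    rw [locMap_apply, AddMonoidAlgebra.mapDomainLinearMap_single, mono,
      AddMonoidAlgebra.single_mul_single, one_mul, add_comm, h]

theorem exists_mono_mul_eq_zero {f : k[Q]} (hf : locMap k P f = 0) :
    ∃ s ∈ P.face, mono k s * f = 0 := by
  let R := Localization (P.faceMonomials k)
  have hfac : Function.FactorsThrough (fun q => algebraMap k[Q] R (mono k q)) P.toLoc := by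
    intro a b hab
    obtain ⟨s, hs, h⟩ := P.toLoc_eq_iff.1 hab
    exact (IsLocalization.eq_iff_exists (P.faceMonomials k) R).2
      ⟨⟨mono k s, s, hs, rfl⟩, by rw [← mono_add, ← mono_add, h]⟩
  let σ : k[P.Loc] →ₗ[k] R :=
    linearExtension (Function.extend P.toLoc (fun q => algebraMap k[Q] R (mono k q)) 0)
  have hσ : σ ∘ₗ AddMonoidAlgebra.mapDomainLinearMap k k P.toLoc =
      (IsScalarTower.toAlgHom k k[Q] R).toLinearMap :=
    linearMap_ext_mono fun q => by
      rw [LinearMap.comp_apply, mapDomainLinearMap_mono, linearExtension_mono,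
        hfac.extend_apply]
      rfl
  have h0 : algebraMap k[Q] R f = 0 :=
    (DFunLike.congr_fun hσ f).symm.trans ((congrArg σ hf).trans (map_zero σ))
  obtain ⟨⟨_, s, hs, rfl⟩, h⟩ := (IsLocalization.map_eq_zero_iff (P.faceMonomials k) R f).1 h0
  exact ⟨s, hs, h⟩

noncomputable instance : Algebra k[Q] k[P.Loc] :=
  (locMap k P).toAlgebra

instance : IsLocalization (P.faceMonomials k) k[P.Loc] := by
  refine (isLocalization_iff _ _).2 ⟨?_, fun g => ?_, fun {f g} hfg => ?_⟩
  · rintro ⟨_, s, hs, rfl⟩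
    exact (locMap_mono (k := k) (P := P) s) ▸ isUnit_mono (P.isAddUnit_toLoc_of_mem_face hs)
  · obtain ⟨s, hs, f, hf⟩ := exists_mono_mul_eq_locMap g
    refine ⟨⟨f, mono k s, s, hs, rfl⟩, ?_⟩
    rw [mul_comm]
    exact (locMap_mono (k := k) (P := P) s) ▸ hf
  · obtain ⟨s, hs, h⟩ := exists_mono_mul_eq_zero (f := f - g) (by
      rw [map_sub, sub_eq_zero]
      exact hfg)
    exact ⟨⟨_, s, hs, rfl⟩, sub_eq_zero.1 ((mul_sub _ _ _).symm.trans h)⟩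

variable {I : Ideal k[Q]} {J : Ideal k[P.Loc]}

theorem locMap_mem_locIdeal_iff {f : k[Q]} :
    locMap k P f ∈ locIdeal I P ↔ ∃ s ∈ P.face, mono k s * f ∈ I := by
  have h := IsLocalization.algebraMap_mem_map_algebraMap_iff (P.faceMonomials k) k[P.Loc] I f
  exact h.trans ⟨fun ⟨_, ⟨s, hs, rfl⟩, h⟩ => ⟨s, hs, h⟩, fun ⟨s, hs, h⟩ => ⟨_, ⟨s, hs, rfl⟩, h⟩⟩

theorem locMap_mem_locIdeal {f : k[Q]} (h : f ∈ I) : locMap k P f ∈ locIdeal I P :=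
  Ideal.mem_map_of_mem _ h

theorem locIdeal_comap (J : Ideal k[P.Loc]) : locIdeal (J.comap (locMap k P)) P = J :=
  IsLocalization.map_under (P.faceMonomials k) k[P.Loc] J

theorem isNoetherianRing_loc [AddMonoid.FG Q] (P : MonoidPrime Q) : IsNoetherianRing k[P.Loc] :=
  IsLocalization.isNoetherianRing (P.faceMonomials k) _ (Algebra.FiniteType.isNoetherianRing k _)

theorem mem_comap_locMap_iff (J : Ideal k[P.Loc]) (f : k[Q]) : f ∈ J.comap (locMap k P) ↔
    AddMonoidAlgebra.mapDomainLinearMap k k P.toLoc f ∈ J :=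
  Iff.rfl

theorem mono_mem_comap_locMap_iff {q : Q} :
    mono k q ∈ J.comap (locMap k P) ↔ mono k (P.toLoc q) ∈ J :=
  mono_mem_iff_of_mem_iff_mapDomain (mem_comap_locMap_iff J)

theorem inducedCon_comap_locMap_iff {p q : Q} :
    inducedCon (J.comap (locMap k P)) p q ↔ inducedCon J (P.toLoc p) (P.toLoc q) :=
  inducedCon_iff_of_mem_iff_mapDomain (mem_comap_locMap_iff J)

theorem IsBinomial.comap_locMap (hJ : IsBinomial J) : IsBinomial (J.comap (locMap k P)) :=
  isBinomial_of_mem_iff_mapDomain hJ (mem_comap_locMap_iff J)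

theorem IsBinomial.locIdeal (hI : IsBinomial I) (P : MonoidPrime Q) : IsBinomial (locIdeal I P) :=
  hI.map P.toLoc

theorem con_add_left_iff {M : Type*} [AddCommMonoid M] (c : AddCon M) {g : M} (hg : IsAddUnit g)
    {x y : M} : c (g + x) (g + y) ↔ c x y := by
  refine ⟨fun h => ?_, c.add (c.refl g)⟩
  obtain ⟨g', hg'⟩ := hg.exists_neg'
  simpa only [← add_assoc, hg', zero_add] using c.add (c.refl g') h

theorem locCon_of_inducedCon_toLoc {a b : Q}
    (h : inducedCon (locIdeal I P) (P.toLoc a) (P.toLoc b)) :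
    locCon (inducedCon I) P (P.toLoc a) (P.toLoc b) := by
  obtain ⟨c, hc⟩ := h
  rw [← locMap_binomial, locMap_mem_locIdeal_iff] at hc
  obtain ⟨s, hs, h⟩ := hc
  rw [mono_mul_binomial] at h
  rw [← con_add_left_iff _ (P.isAddUnit_toLoc_of_mem_face hs), ← map_add, ← map_add]
  exact AddConGen.Rel.of _ _ ⟨_, _, ⟨c, h⟩, rfl, rfl⟩

theorem locCon_inducedCon (I : Ideal k[Q]) (P : MonoidPrime Q) :
    locCon (inducedCon I) P = inducedCon (locIdeal I P) := by
  refine le_antisymm (AddCon.addConGen_le.2 ?_) fun x y h => ?_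
  · rintro x y ⟨a, b, ⟨c, hc⟩, rfl, rfl⟩
    exact ⟨c, by rw [← locMap_binomial]; exact locMap_mem_locIdeal hc⟩
  · obtain ⟨a, s, hs, ha⟩ := P.toLoc_surj x
    obtain ⟨b, t, ht, hb⟩ := P.toLoc_surj y
    have hx : P.toLoc (s + t) + x = P.toLoc (a + t) := by
      rw [map_add, map_add, ← ha]
      abel
    have hy : P.toLoc (s + t) + y = P.toLoc (b + s) := by
      rw [map_add, map_add, ← hb]
      abel
    have hu := P.isAddUnit_toLoc_of_mem_face (P.face.add_mem hs ht)
    rw [← con_add_left_iff _ hu, hx, hy] at h ⊢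
    exact locCon_of_inducedCon_toLoc h

end Localization

section Congruences

variable {M : Type*} [AddCommMonoid M] {c : AddCon M} {x y z : M}

/-- Green's preorder on the quotient by a congruence, read off on representatives. -/
def PrecedesMod (c : AddCon M) (x y : M) : Prop := ∃ u, c (x + u) y

theorem greenLE_coe_iff : GreenLE (x : c.Quotient) (y : c.Quotient) ↔ PrecedesMod c x y :=
  AddCon.mk'_surjective.exists.trans (exists_congr fun _ => AddCon.eq c)

theorem isNil_coe_iff :
    IsNil (x : c.Quotient) ↔ (∃ y, ¬ c y x) ∧ ∀ y, c (y + x) x :=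
  and_congr (AddCon.mk'_surjective.exists.trans (exists_congr fun _ => not_congr (AddCon.eq c)))
    (AddCon.mk'_surjective.forall.trans (forall_congr' fun _ => AddCon.eq c))

theorem PrecedesMod.of_con (h : c x y) : PrecedesMod c x y :=
  ⟨0, by rwa [add_zero]⟩

theorem PrecedesMod.refl (c : AddCon M) (x : M) : PrecedesMod c x x :=
  .of_con (c.refl x)

theorem PrecedesMod.trans (h : PrecedesMod c x y) (h' : PrecedesMod c y z) :
    PrecedesMod c x z := by
  obtain ⟨u, hu⟩ := h
  obtain ⟨v, hv⟩ := h'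
  exact ⟨u + v, add_assoc x u v ▸ c.trans (c.add hu (c.refl v)) hv⟩

theorem PrecedesMod.of_add_left (h : PrecedesMod c (y + x) z) : PrecedesMod c x z := by
  obtain ⟨u, hu⟩ := h
  exact ⟨y + u, by rwa [add_left_comm, ← add_assoc]⟩

theorem precedesMod_add_left_iff (hx : IsAddUnit x) :
    PrecedesMod c (x + y) z ↔ PrecedesMod c y z := by
  refine ⟨.of_add_left, fun ⟨u, hu⟩ => ?_⟩
  obtain ⟨x', hx'⟩ := hx.exists_neg
  exact ⟨x' + u, by rwa [add_add_add_comm, hx', zero_add]⟩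

/-- Only units stabilize the class of `x`. -/
def StabilizedByUnits (c : AddCon M) (x : M) : Prop := ∀ u, c (u + x) x → IsAddUnit u

end Congruences

section LocalCongruences

variable {k : Type*} [Field k] {Q : Type*} [AddCommMonoid Q] {P : MonoidPrime Q} {I : Ideal k[Q]}
  {x y : P.Loc} {w : Q}

theorem coe_locQuot_eq_iff :
    (x : LocQuot (inducedCon I) P) = (y : LocQuot (inducedCon I) P) ↔
      inducedCon (locIdeal I P) x y := by
  rw [AddCon.eq, locCon_inducedCon]

theorem greenLE_locQuot_iff :
    GreenLE (x : LocQuot (inducedCon I) P) (y : LocQuot (inducedCon I) P) ↔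
      PrecedesMod (inducedCon (locIdeal I P)) x y := by
  rw [greenLE_coe_iff, locCon_inducedCon]

theorem mem_orderIdeal_iff {q : Q} : q ∈ orderIdeal (inducedCon I) P w ↔
    PrecedesMod (inducedCon (locIdeal I P)) (P.toLoc q) (P.toLoc w) :=
  greenLE_locQuot_iff

theorem mem_stabilizer_iff {g : AddUnits P.Loc} : g ∈ stabilizer I P w ↔
    inducedCon (locIdeal I P) ((g : P.Loc) + P.toLoc w) (P.toLoc w) := by
  rw [← locCon_inducedCon]
  exact Iff.rfl

theorem stabilizedByUnits_of_forall_notMem_orderIdeal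
    (h : ∀ p ∈ P.carrier, p + w ∉ orderIdeal (inducedCon I) P w) :
    StabilizedByUnits (inducedCon (locIdeal I P)) (P.toLoc w) := by
  intro u hu
  by_contra hnu
  obtain ⟨g, hg, p, hpP, hp⟩ := P.exists_mem_carrier_of_not_isAddUnit hnu
  refine h p hpP (mem_orderIdeal_iff.2 ?_)
  rw [map_add, ← hp, add_assoc, precedesMod_add_left_iff hg]
  exact .of_con hu

end LocalCongruences

section Characters

variable {k : Type*} [Field k] {S : Type*} [AddCommMonoid S] {J : Ideal k[S]} {x : S}
  {K : AddSubgroup (AddUnits S)} {ρ : Multiplicative K →* kˣ}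

theorem exists_coe_eq_add_iff (g : K) (u : S) :
    (∃ h : K, ((h : AddUnits S) : S) = (g : AddUnits S) + u) ↔
      ∃ h : K, ((h : AddUnits S) : S) = u := by
  refine ⟨fun ⟨h, hh⟩ => ⟨-g + h, ?_⟩, fun ⟨h, hh⟩ => ⟨g + h, by simp [hh]⟩⟩
  simp [hh]

/-- `K` is the stabilizer of the class of `t ^ x` modulo `J`, which contains only units, and acts on
that class through the character `ρ`. -/
structure IsMonomialCharacter (J : Ideal k[S]) (x : S) {K : AddSubgroup (AddUnits S)}
    (ρ : Multiplicative K →* kˣ) : Prop where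
  mono_notMem : mono k x ∉ J
  sub_mem : ∀ g : K, mono k (((g : AddUnits S) : S) + x)
    - (ρ (Multiplicative.ofAdd g) : k) • mono k x ∈ J
  exists_coe_eq : ∀ u, inducedCon J (u + x) x → ∃ g : K, ((g : AddUnits S) : S) = u

theorem exists_character (hx : mono k x ∉ J) (hK : ∀ g : K, inducedCon J ((g : AddUnits S) + x) x) :
    ∃ ρ : Multiplicative K →* kˣ, ∀ g : K, mono k (((g : AddUnits S) : S) + x)
      - (ρ (Multiplicative.ofAdd g) : k) • mono k x ∈ J := by
  choose χ hχ using hK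
  refine ⟨MonoidHom.mk' (fun g => χ g.toAdd) fun g g' => Units.ext ?_, hχ⟩
  refine scalar_unique hx (hχ (g.toAdd + g'.toAdd)) ?_
  have h := J.mul_mem_left (mono k ((g.toAdd : AddUnits S) : S)) (hχ g'.toAdd)
  rw [mono_mul_binomial] at h
  have h' := J.add_mem h (Submodule.smul_of_tower_mem J (χ g'.toAdd : k) (hχ g.toAdd))
  rw [smul_sub, smul_smul, sub_add_sub_cancel, ← add_assoc] at h'
  rw [Units.val_mul, mul_comm]
  exact h'

theorem IsMonomialCharacter.eq {ρ' : Multiplicative K →* kˣ} (hρ : IsMonomialCharacter J x ρ)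
    (hρ' : IsMonomialCharacter J x ρ') : ρ = ρ' :=
  MonoidHom.ext fun g =>
    Units.ext (scalar_unique hρ.mono_notMem (hρ.sub_mem g.toAdd) (hρ'.sub_mem g.toAdd))

theorem IsMonomialCharacter.stabilizedByUnits (hρ : IsMonomialCharacter J x ρ) :
    StabilizedByUnits (inducedCon J) x := by
  intro u hu
  obtain ⟨g, rfl⟩ := hρ.exists_coe_eq u hu
  exact g.1.isAddUnit

theorem IsMonomialCharacter.exists_add_eq (hρ : IsMonomialCharacter J x ρ) {p q : S}
    (hq : IsAddUnit q) (h : inducedCon J (p + x) (q + x)) :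
    ∃ g : K, ((g : AddUnits S) : S) + q = p := by
  obtain ⟨q, rfl⟩ := hq
  obtain ⟨g, hg⟩ := hρ.exists_coe_eq (((-q : AddUnits S) : S) + p) (by
    rw [← con_add_left_iff _ q.isAddUnit, ← add_assoc, ← add_assoc, AddUnits.add_neg, zero_add]
    exact h)
  exact ⟨g, by rw [hg, add_right_comm, AddUnits.neg_add, zero_add]⟩

theorem sub_mem_colon_mono_iff {p q : S} {c : k} : mono k p - c • mono k q ∈ J.colon {mono k x} ↔
    mono k (p + x) - c • mono k (q + x) ∈ J := by
  rw [mem_colon_mono_iff, mono_mul_binomial, add_comm x, add_comm x]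

end Characters

section CharacterIdeals

variable {k : Type*} [Field k] {Q : Type*} [AddCommMonoid Q] {P : MonoidPrime Q} {I : Ideal k[Q]}
  {J : Ideal k[P.Loc]} {x : P.Loc} {w : Q} {K : AddSubgroup (AddUnits P.Loc)}
  {ρ : Multiplicative K →* kˣ}

theorem mono_mem_primeMonomialIdeal {x : P.Loc} (hx : ¬ IsAddUnit x) :
    mono k x ∈ primeMonomialIdeal k P := by
  obtain ⟨g, hg, p, hpP, hp⟩ := P.exists_mem_carrier_of_not_isAddUnit hx
  rw [← mono_add_mem_iff hg, hp]
  exact Ideal.subset_span ⟨p, hpP, rfl⟩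

theorem isBinomial_characterIdeal (ρ : Multiplicative K →* kˣ) : IsBinomial (characterIdeal ρ) :=
  ⟨_, by rintro _ ⟨g, v, rfl⟩; exact ⟨_, _, _, rfl⟩, rfl⟩

/- The functional extends `ρ` by zero from `K` to the whole monoid. -/
theorem exists_character_functional (ρ : Multiplicative K →* kˣ) : ∃ φ : k[P.Loc] →ₗ[k] k,
    (∀ f ∈ characterIdeal ρ ⊔ primeMonomialIdeal k P, φ f = 0) ∧
      ∀ g : K, φ (mono k ((g : AddUnits P.Loc) : P.Loc)) = (ρ (Multiplicative.ofAdd g) : k) := by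
  have hinj : Function.Injective fun g : K => ((g : AddUnits P.Loc) : P.Loc) :=
    AddUnits.val_injective.comp Subtype.val_injective
  let χ : P.Loc → k := Function.extend (fun g : K => ((g : AddUnits P.Loc) : P.Loc))
    (fun g => (ρ (Multiplicative.ofAdd g) : k)) 0
  have hχ (g : K) : χ ((g : AddUnits P.Loc) : P.Loc) = ρ (Multiplicative.ofAdd g) :=
    hinj.extend_apply _ _ g
  have hχ0 {u : P.Loc} (hu : ¬ ∃ g : K, ((g : AddUnits P.Loc) : P.Loc) = u) : χ u = 0 :=
    Function.extend_apply' _ _ u hu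
  have hadd (g : K) (u : P.Loc) :
      χ ((g : AddUnits P.Loc) + u) = ρ (Multiplicative.ofAdd g) * χ u := by
    by_cases hu : ∃ h : K, ((h : AddUnits P.Loc) : P.Loc) = u
    · obtain ⟨h, rfl⟩ := hu
      have := hχ (g + h)
      rw [ofAdd_add, map_mul, Units.val_mul] at this
      rw [hχ h, ← this]
      rfl
    · rw [hχ0 hu, hχ0 (mt (exists_coe_eq_add_iff g u).1 hu), mul_zero]
  refine ⟨linearExtension χ, fun f hf => ?_, fun g => by rw [linearExtension_mono, hχ]⟩
  rw [characterIdeal, primeMonomialIdeal, ← Ideal.span_union] at hf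
  refine map_eq_zero_of_mem_span _ ?_ hf
  rintro a f (⟨g, v, rfl⟩ | ⟨p, hp, rfl⟩)
  · rw [mono_mul_binomial, map_sub, map_smul, linearExtension_mono, linearExtension_mono,
      add_left_comm, hadd, smul_eq_mul, sub_self]
  · rw [← mono_add, linearExtension_mono]
    refine hχ0 fun ⟨g, hg⟩ => P.not_isAddUnit_toLoc hp ?_
    exact isAddUnit_of_add_isAddUnit_right (hg ▸ g.1.isAddUnit)

theorem one_notMem_characterIdeal_sup (ρ : Multiplicative K →* kˣ) :
    (1 : k[P.Loc]) ∉ characterIdeal ρ ⊔ primeMonomialIdeal k P := by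
  obtain ⟨φ, h0, h1⟩ := exists_character_functional ρ
  intro h
  exact (ρ (Multiplicative.ofAdd 0)).ne_zero ((h1 0).symm.trans (h0 _ h))

theorem eq_of_sub_mem_characterIdeal_sup {g : K} {c : k}
    (h : mono k ((g : AddUnits P.Loc) : P.Loc) - c • mono k 0 ∈
      characterIdeal ρ ⊔ primeMonomialIdeal k P) : (ρ (Multiplicative.ofAdd g) : k) = c := by
  obtain ⟨φ, h0, h1⟩ := exists_character_functional ρ
  have hφ1 : φ (mono k 0) = 1 := by simpa using h1 0
  have hφ := h0 _ h
  rwa [map_sub, map_smul, h1, hφ1, smul_eq_mul, mul_one, sub_eq_zero] at hφ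

theorem characterIdeal_le_colon (hρ : IsMonomialCharacter J x ρ) :
    characterIdeal ρ ≤ J.colon {mono k x} := by
  refine Ideal.span_le.2 ?_
  rintro _ ⟨g, v, rfl⟩
  have h := J.mul_mem_left (mono k v) (hρ.sub_mem g)
  rw [mono_mul_binomial, add_left_comm, ← add_assoc] at h
  exact sub_mem_colon_mono_iff.2 h

theorem IsMonomialCharacter.sub_mem_of_sub_mem_colon (hρ : IsMonomialCharacter J x ρ) {p q : P.Loc}
    {c : k} (h : mono k p - c • mono k q ∈ J.colon {mono k x}) :
    mono k p - c • mono k q ∈ characterIdeal ρ ⊔ primeMonomialIdeal k P := by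
  have hJ := sub_mem_colon_mono_iff.1 h
  by_cases hc : c = 0
  · rw [hc, zero_smul, sub_zero] at hJ ⊢
    exact Ideal.mem_sup_right
      (mono_mem_primeMonomialIdeal fun hp => hρ.mono_notMem ((mono_add_mem_iff hp).1 hJ))
  have hcon : inducedCon J (p + x) (q + x) := ⟨Units.mk0 c hc, hJ⟩
  by_cases hq : IsAddUnit q
  · obtain ⟨g, rfl⟩ := hρ.exists_add_eq hq hcon
    have hg : mono k (((g : AddUnits P.Loc) : P.Loc) + q)
        - (ρ (Multiplicative.ofAdd g) : k) • mono k q ∈ characterIdeal ρ :=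
      Ideal.subset_span ⟨g, q, rfl⟩
    have hqx : mono k (q + x) ∉ J := (mono_add_mem_iff hq).not.2 hρ.mono_notMem
    rw [scalar_unique hqx hJ (sub_mem_colon_mono_iff.1 (characterIdeal_le_colon hρ hg))]
    exact Ideal.mem_sup_left hg
  · have hp : ¬ IsAddUnit p := by
      intro hp
      obtain ⟨g, rfl⟩ := hρ.exists_add_eq hp ((inducedCon J).symm hcon)
      exact hq (g.1.isAddUnit.add hp)
    exact Ideal.mem_sup_right ((primeMonomialIdeal k P).sub_mem (mono_mem_primeMonomialIdeal hp)
      (Submodule.smul_of_tower_mem _ c (mono_mem_primeMonomialIdeal hq)))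

theorem IsMonomialCharacter.colon_sup_eq (hρ : IsMonomialCharacter J x ρ) (hJ : IsBinomial J) :
    J.colon {mono k x} ⊔ primeMonomialIdeal k P = characterIdeal ρ ⊔ primeMonomialIdeal k P := by
  refine le_antisymm (sup_le ?_ le_sup_right) (sup_le_sup_right (characterIdeal_le_colon hρ) _)
  obtain ⟨T, hT, hcolon⟩ := hJ.colon_mono x
  rw [hcolon, Ideal.span_le]
  intro f hf
  obtain ⟨p, q, c, rfl⟩ := hT f hf
  exact hρ.sub_mem_of_sub_mem_colon (hcolon ▸ Ideal.subset_span hf)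

theorem isMonomialCharacter_of_sub_mem {ρ : Multiplicative (stabilizer I P w) →* kˣ}
    (hw : mono k (P.toLoc w) ∉ locIdeal I P)
    (hunits : StabilizedByUnits (inducedCon (locIdeal I P)) (P.toLoc w))
    (hρ : ∀ g : stabilizer I P w, mono k (((g : AddUnits P.Loc) : P.Loc) + P.toLoc w)
      - (ρ (Multiplicative.ofAdd g) : k) • mono k (P.toLoc w) ∈ locIdeal I P) :
    IsMonomialCharacter (locIdeal I P) (P.toLoc w) ρ where
  mono_notMem := hw
  sub_mem := hρ
  exists_coe_eq u hu := by
    obtain ⟨g, rfl⟩ := hunits u hu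
    exact ⟨⟨g, mem_stabilizer_iff.2 hu⟩, rfl⟩

theorem IsCharacterAt.isMonomialCharacter {ρ : Multiplicative (stabilizer I P w) →* kˣ}
    (hρ : IsCharacterAt I P w ρ) : IsMonomialCharacter (locIdeal I P) (P.toLoc w) ρ := by
  have hle : (locIdeal I P).colon {mono k (P.toLoc w)} ≤
      characterIdeal ρ ⊔ primeMonomialIdeal k P := le_sup_left.trans_eq hρ.symm
  have h1 := one_notMem_characterIdeal_sup (k := k) (P := P) ρ
  have hsub {u : P.Loc} {c : k} (h : mono k (u + P.toLoc w) - c • mono k (P.toLoc w) ∈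
      locIdeal I P) : mono k u - c • 1 ∈ characterIdeal ρ ⊔ primeMonomialIdeal k P := by
    refine hle (sub_mem_colon_mono_iff.2 ?_)
    rwa [zero_add]
  refine isMonomialCharacter_of_sub_mem (fun hw => h1 (hle ?_)) (fun u ⟨c, hc⟩ => ?_) fun g => ?_
  · rwa [mem_colon_mono_iff, mul_one]
  · by_contra hu
    have hc1 := (Submodule.sub_mem_iff_right _
      (Ideal.mem_sup_right (mono_mem_primeMonomialIdeal hu))).1 (hsub hc)
    exact h1 ((smul_mem_ideal_iff c.ne_zero).1 hc1)
  · obtain ⟨c, hc⟩ := mem_stabilizer_iff.1 g.2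
    rwa [eq_of_sub_mem_characterIdeal_sup (hsub hc)]

theorem isCharacterAt_iff (hI : IsBinomial I) {ρ : Multiplicative (stabilizer I P w) →* kˣ} :
    IsCharacterAt I P w ρ ↔ IsMonomialCharacter (locIdeal I P) (P.toLoc w) ρ :=
  ⟨IsCharacterAt.isMonomialCharacter, fun hρ => (hρ.colon_sup_eq (hI.locIdeal P)).symm⟩

theorem existsUnique_isCharacterAt (hI : IsBinomial I) (hw : mono k (P.toLoc w) ∉ locIdeal I P)
    (hunits : StabilizedByUnits (inducedCon (locIdeal I P)) (P.toLoc w)) :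
    ∃! ρ : Multiplicative (stabilizer I P w) →* kˣ, IsCharacterAt I P w ρ := by
  simp only [isCharacterAt_iff hI]
  obtain ⟨ρ, hρ⟩ := exists_character (K := stabilizer I P w) hw
    fun g => mem_stabilizer_iff.1 g.2
  exact ⟨ρ, isMonomialCharacter_of_sub_mem hw hunits hρ, fun ρ' hρ' =>
    hρ'.eq (isMonomialCharacter_of_sub_mem hw hunits hρ)⟩

end CharacterIdeals

section CogeneratedBy

variable {k : Type*} [Field k] {S : Type*} [AddCommMonoid S] {W : Ideal k[S]} {x y : S}

theorem isNil_coe_of_mono_mem (hW : W ≠ ⊤) (hy : mono k y ∈ W) :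
    IsNil (y : (inducedCon W).Quotient) := by
  refine isNil_coe_iff.2 ⟨⟨0, fun h => hW ?_⟩,
    fun z => inducedCon_of_mono_mem (mono_add_mem z hy) hy⟩
  exact (Ideal.eq_top_iff_one W).2 ((mono_mem_iff_of_inducedCon h).2 hy)

/-- `W` is a proper ideal whose monomials are cogenerated by `t ^ x`: the class of `x` modulo `W` is
killed by all nonunits, and it is divisible by every other surviving class. Moreover `x` is
cancellative as far as its stabilizer is concerned. -/
structure IsCogeneratedBy (W : Ideal k[S]) (x : S) : Prop where
  mono_notMem : mono k x ∉ W
  nonunit_add_mem : ∀ u, ¬ IsAddUnit u → mono k (u + x) ∈ W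
  precedesMod : ∀ y, mono k y ∉ W → PrecedesMod (inducedCon W) y x
  inducedCon_zero : ∀ u, inducedCon W (u + x) x → inducedCon W u 0

namespace IsCogeneratedBy

variable (hW : IsCogeneratedBy W x)
include hW

theorem ne_top : W ≠ ⊤ := by
  rintro rfl
  exact hW.mono_notMem trivial

theorem exists_nsmul_mem [IsNoetherianRing k[S]] {u : S} (hu : ¬ IsAddUnit u) :
    ∃ n : ℕ, mono k (n • u) ∈ W := by
  obtain ⟨n, hn⟩ := monotone_stabilizes_iff_noetherian.2 ‹IsNoetherianRing k[S]›
    ⟨fun n => W.colon {mono k (n • u)}, monotone_nat_of_le_succ fun n f hf => by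
      rw [mem_colon_mono_iff] at hf ⊢
      rw [succ_nsmul', mono_add, mul_assoc]
      exact W.mul_mem_left _ hf⟩
  refine ⟨n, by_contra fun hnu => hW.mono_notMem ?_⟩
  obtain ⟨v, hv⟩ := hW.precedesMod _ hnu
  have hv' : inducedCon W ((n + 1) • u + v) (u + x) := by
    rw [succ_nsmul', add_assoc]
    exact inducedCon_add_left u hv
  have hmem : mono k v ∈ W.colon {mono k ((n + 1) • u)} := by
    rw [mem_colon_mono_iff, ← mono_add, mono_mem_iff_of_inducedCon hv']
    exact hW.nonunit_add_mem u hu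
  rw [← mono_mem_iff_of_inducedCon hv, mono_add, ← mem_colon_mono_iff]
  exact (hn (n + 1) n.le_succ).ge hmem

theorem inducedCon_of_add {a b : S} (hb : IsAddUnit b)
    (hy : mono k (y + a) ∉ W) (h : inducedCon W (y + a) (y + b)) : inducedCon W a b := by
  obtain ⟨b, rfl⟩ := hb
  obtain ⟨u, hu⟩ := hW.precedesMod _ hy
  have hg : a + ((-b : AddUnits S) : S) + b = a := by
    rw [add_assoc, AddUnits.neg_add, add_zero]
  generalize a + ((-b : AddUnits S) : S) = g at hg
  have hbu : inducedCon W (y + b + u) x :=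
    (inducedCon W).trans ((inducedCon W).add ((inducedCon W).symm h) ((inducedCon W).refl u)) hu
  have hgx : inducedCon W (g + x) x := by
    refine (inducedCon W).trans ((inducedCon W).symm (inducedCon_add_left g hbu)) ?_
    rwa [add_right_comm y, ← add_assoc, add_comm g, add_assoc (y + u), hg, add_right_comm]
  simpa only [hg, zero_add] using
    (inducedCon W).add (hW.inducedCon_zero g hgx) ((inducedCon W).refl (b : S))

theorem not_isNil : ¬ IsNil (x : (inducedCon W).Quotient) := by
  intro h
  obtain ⟨⟨y, hy⟩, hx⟩ := isNil_coe_iff.1 h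
  have h0 (u : S) : inducedCon W u 0 := hW.inducedCon_zero u (hx u)
  exact hy ((inducedCon W).trans (h0 y) ((inducedCon W).symm (h0 x)))

theorem coe_mem_socle : (x : (inducedCon W).Quotient) ∈ socle (inducedCon W).Quotient := by
  refine ⟨hW.not_isNil, AddCon.mk'_surjective.forall.2 fun u hu => ?_⟩
  rw [add_comm]
  exact isNil_coe_of_mono_mem hW.ne_top
    (hW.nonunit_add_mem u fun h => hu (h.map (inducedCon W).mk'))

theorem greenLE_of_mem_socle {s : (inducedCon W).Quotient}
    (hs : s ∈ socle (inducedCon W).Quotient) :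
    GreenLE s (x : (inducedCon W).Quotient) ∧ GreenLE (x : (inducedCon W).Quotient) s := by
  obtain ⟨y, rfl⟩ := AddCon.mk'_surjective s
  obtain ⟨u, hu⟩ := hW.precedesMod y fun hy => hs.1 (isNil_coe_of_mono_mem hW.ne_top hy)
  have hyu : (inducedCon W).mk' y + (inducedCon W).mk' u = x := (AddCon.eq _).2 hu
  have hunit : IsAddUnit ((inducedCon W).mk' u) := by
    by_contra hnu
    exact hW.not_isNil (hyu ▸ hs.2 _ hnu)
  obtain ⟨v, hv⟩ := hunit.exists_neg
  exact ⟨⟨_, hyu⟩, v, by rw [← hyu, add_assoc, hv, add_zero]⟩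

theorem greenLE_of_mem_socle_of_mem_socle {s s' : (inducedCon W).Quotient}
    (hs : s ∈ socle (inducedCon W).Quotient) (hs' : s' ∈ socle (inducedCon W).Quotient) :
    GreenLE s s' := by
  obtain ⟨u, hu⟩ := (hW.greenLE_of_mem_socle hs).1
  obtain ⟨v, hv⟩ := (hW.greenLE_of_mem_socle hs').2
  exact ⟨u + v, by rw [← add_assoc, hu, hv]⟩

theorem exists_isAddUnit_inducedCon (hy : mono k y ∉ W)
    (hann : ∀ u, ¬ IsAddUnit u → mono k (u + y) ∈ W) :
    ∃ g, IsAddUnit g ∧ inducedCon W (g + y) x := by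
  obtain ⟨u, hu⟩ := hW.precedesMod y hy
  rw [add_comm] at hu
  refine ⟨u, by_contra fun hnu => hW.mono_notMem ?_, hu⟩
  exact (mono_mem_iff_of_inducedCon hu).1 (hann u hnu)

end IsCogeneratedBy

end CogeneratedBy

section Mesoprimary

variable {M : Type*} [AddCommMonoid M] {x : M}

theorem IsCancellative.not_isNil (hx : IsCancellative x) : ¬ IsNil x := by
  rintro ⟨⟨y, hy⟩, h⟩
  have h0 (z : M) : z = 0 := hx z 0 (by rw [add_comm, h, add_zero])
  exact hy ((h0 y).trans (h0 x).symm)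

theorem IsCancellative.nsmul (hx : IsCancellative x) (n : ℕ) : IsCancellative (n • x) := by
  induction n with
  | zero => intro a b h; rwa [zero_nsmul, zero_add, zero_add] at h
  | succ n ih => intro a b h; rw [succ_nsmul', add_assoc, add_assoc] at h; exact ih a b (hx _ _ h)

theorem IsCancellative.not_isNilpotentElt (hx : IsCancellative x) : ¬ IsNilpotentElt x :=
  fun ⟨n, hn⟩ => (hx.nsmul n).not_isNil hn

variable {k : Type*} [Field k] {Q : Type*} [AddCommMonoid Q] {P : MonoidPrime Q}
  {W : Ideal k[P.Loc]} {x : P.Loc}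

theorem isCancellative_coe_of_notMem {q : Q} (hq : q ∉ P.carrier) :
    IsCancellative (q : (inducedCon (W.comap (locMap k P))).Quotient) := by
  refine AddCon.mk'_surjective.forall.2 fun a => AddCon.mk'_surjective.forall.2 fun b h => ?_
  have hab : inducedCon W (P.toLoc (q + a)) (P.toLoc (q + b)) :=
    inducedCon_comap_locMap_iff.1 ((AddCon.eq _).1 h)
  rw [map_add P.toLoc, map_add P.toLoc, con_add_left_iff _ (P.isAddUnit_toLoc_iff.2 hq)] at hab
  exact (AddCon.eq _).2 (inducedCon_comap_locMap_iff.2 hab)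

namespace IsCogeneratedBy

variable (hW : IsCogeneratedBy W x)
include hW

theorem comap_locMap_ne_top : W.comap (locMap k P) ≠ ⊤ :=
  Ideal.comap_ne_top _ hW.ne_top

theorem isNilpotentElt_coe [IsNoetherianRing k[P.Loc]] {q : Q} (hq : q ∈ P.carrier) :
    IsNilpotentElt (q : (inducedCon (W.comap (locMap k P))).Quotient) := by
  obtain ⟨n, hn⟩ := hW.exists_nsmul_mem (P.not_isAddUnit_toLoc hq)
  rw [← map_nsmul, ← mono_mem_comap_locMap_iff] at hn
  exact ⟨n, isNil_coe_of_mono_mem hW.comap_locMap_ne_top hn⟩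

theorem notMem_carrier_of_isCancellative [IsNoetherianRing k[P.Loc]] {q : Q}
    (hq : IsCancellative (q : (inducedCon (W.comap (locMap k P))).Quotient)) : q ∉ P.carrier :=
  fun h => hq.not_isNilpotentElt (hW.isNilpotentElt_coe h)

theorem isPartlyCancellative [IsNoetherianRing k[P.Loc]]
    (s : (inducedCon (W.comap (locMap k P))).Quotient) : IsPartlyCancellative s := by
  obtain ⟨y, rfl⟩ := AddCon.mk'_surjective s
  refine AddCon.mk'_surjective.forall.2 fun a =>
    AddCon.mk'_surjective.forall.2 fun b _ hb h hn => ?_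
  refine (AddCon.eq _).2 (inducedCon_comap_locMap_iff.2 (hW.inducedCon_of_add (y := P.toLoc y)
    (P.isAddUnit_toLoc_iff.2 (hW.notMem_carrier_of_isCancellative hb)) (fun hy => hn ?_) ?_))
  · rw [← map_add, ← mono_mem_comap_locMap_iff] at hy
    exact isNil_coe_of_mono_mem hW.comap_locMap_ne_top hy
  · rw [← map_add, ← map_add]
    exact inducedCon_comap_locMap_iff.1 ((AddCon.eq _).1 h)

theorem isMesoprimaryConFor [IsNoetherianRing k[P.Loc]] :
    IsMesoprimaryConFor (inducedCon (W.comap (locMap k P))) P := by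
  refine ⟨⟨AddCon.mk'_surjective.forall.2 fun q => ?_, hW.isPartlyCancellative⟩, ?_⟩
  · by_cases hq : q ∈ P.carrier
    exacts [.inl (hW.isNilpotentElt_coe hq), .inr (isCancellative_coe_of_notMem hq)]
  · ext q
    refine ⟨hW.isNilpotentElt_coe, fun h => by_contra fun hq => ?_⟩
    exact (isCancellative_coe_of_notMem hq).not_isNilpotentElt h

theorem isCoprincipalCon [IsNoetherianRing k[P.Loc]] :
    IsCoprincipalCon (inducedCon (W.comap (locMap k P))) := by
  refine ⟨P, hW.isMesoprimaryConFor, ?_⟩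
  unfold LocQuot
  rw [locCon_inducedCon, locIdeal_comap]
  exact ⟨⟨_, hW.coe_mem_socle⟩, fun s hs s' hs' =>
    ⟨hW.greenLE_of_mem_socle_of_mem_socle hs hs', hW.greenLE_of_mem_socle_of_mem_socle hs' hs⟩⟩

theorem inducedCon_comap_zero_of_forall_mono_notMem
    (hC : ∀ q, mono k q ∉ W.comap (locMap k P)) {u : Q}
    (hu : inducedCon (W.comap (locMap k P)) (u + u) u) :
    inducedCon (W.comap (locMap k P)) u 0 := by
  have hunit : u ∉ P.carrier := by
    intro hP
    obtain ⟨g, hg, q, hq⟩ := P.exists_isAddUnit_add_eq_toLoc (P.toLoc u + x)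
    refine hC q (mono_mem_comap_locMap_iff.2 ?_)
    rw [← hq, mono_add_mem_iff hg]
    exact hW.nonunit_add_mem _ (P.not_isAddUnit_toLoc hP)
  rw [inducedCon_comap_locMap_iff] at hu ⊢
  rw [← con_add_left_iff _ (P.isAddUnit_toLoc_iff.2 hunit), ← map_add, ← map_add, add_zero]
  exact hu

theorem isMaximalForCon (hbin : IsBinomial W) : IsMaximalForCon (W.comap (locMap k P)) := by
  refine ⟨⟨hbin.comap_locMap, hW.comap_locMap_ne_top, rfl⟩, fun J ⟨hJ, hJtop, hcon⟩ hle => ?_⟩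
  refine hJ.le_of_inducedCon_le hle (fun u hu => ?_) hcon.le
  by_cases hC : ∃ v, mono k v ∈ W.comap (locMap k P)
  · obtain ⟨v, hv⟩ := hC
    exact (mono_mem_iff_of_inducedCon (hcon.le (inducedCon_of_mono_mem hu (hle hv)))).2 hv
  · have hu0 := hW.inducedCon_comap_zero_of_forall_mono_notMem (not_exists.1 hC)
      (hcon.le (inducedCon_of_mono_mem (mono_add_mem u hu) hu))
    have h1 : mono k 0 ∈ J := (mono_mem_iff_of_inducedCon (hcon.ge hu0)).1 hu
    exact (hJtop ((Ideal.eq_top_iff_one J).2 h1)).elim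

end IsCogeneratedBy

end Mesoprimary

section CogeneratedIdeals

variable {k : Type*} [Field k] {Q : Type*} [AddCommMonoid Q] {P : MonoidPrime Q}
  {J : Ideal k[P.Loc]} {x : P.Loc} {K : AddSubgroup (AddUnits P.Loc)} {ρ : Multiplicative K →* kˣ}

/-- The extension of `W_w^P(I)` to `k[Q]_P`, for `x` the image of `w` and `J = I_P`. -/
noncomputable def cogeneratedIdeal (J : Ideal k[P.Loc]) (x : P.Loc)
    {K : AddSubgroup (AddUnits P.Loc)} (ρ : Multiplicative K →* kˣ) : Ideal k[P.Loc] :=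
  J ⊔ characterIdeal ρ ⊔ Ideal.span (mono k '' {u | ¬ PrecedesMod (inducedCon J) u x})

theorem le_cogeneratedIdeal : J ≤ cogeneratedIdeal J x ρ :=
  le_sup_left.trans le_sup_left

theorem characterIdeal_le_cogeneratedIdeal : characterIdeal ρ ≤ cogeneratedIdeal J x ρ :=
  le_sup_right.trans le_sup_left

theorem isBinomial_cogeneratedIdeal (hJ : IsBinomial J) : IsBinomial (cogeneratedIdeal J x ρ) :=
  (hJ.sup (isBinomial_characterIdeal ρ)).sup (isBinomial_span_mono _)

theorem IsMonomialCharacter.sub_mem_of_inducedCon (hρ : IsMonomialCharacter J x ρ) (g : K)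
    {y : P.Loc} (hy : inducedCon J y x) : mono k (((g : AddUnits P.Loc) : P.Loc) + y)
      - (ρ (Multiplicative.ofAdd g) : k) • mono k y ∈ J := by
  have h := hρ.sub_mem g
  rw [← zero_add x, add_left_comm, zero_add, ← sub_mem_colon_mono_iff,
    ← colon_mono_eq_of_inducedCon hy, sub_mem_colon_mono_iff] at h
  simpa only [zero_add] using h

/- The coordinate of the class of `x` modulo `J` also kills the two ideals added to `J`. -/
theorem IsMonomialCharacter.exists_functional (hρ : IsMonomialCharacter J x ρ)
    (hJ : IsBinomial J) : ∃ φ : k[P.Loc] →ₗ[k] k, (∀ f ∈ cogeneratedIdeal J x ρ, φ f = 0) ∧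
      φ (mono k x) = 1 ∧ ∀ u, ¬ inducedCon J u x → φ (mono k u) = 0 := by
  obtain ⟨φ, hφJ, hφx, hφ0⟩ := hJ.exists_functional hρ.mono_notMem
  refine ⟨φ, fun f hf => ?_, hφx, hφ0⟩
  have hφchar (g : K) (u : P.Loc) : φ (mono k (((g : AddUnits P.Loc) : P.Loc) + u)
      - (ρ (Multiplicative.ofAdd g) : k) • mono k u) = 0 := by
    by_cases hu : inducedCon J u x
    · exact hφJ _ (hρ.sub_mem_of_inducedCon g hu)
    · have hgu : ¬ inducedCon J (((g : AddUnits P.Loc) : P.Loc) + u) x := fun h =>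
        hu ((con_add_left_iff _ g.1.isAddUnit).1
          ((inducedCon J).trans h ((inducedCon J).symm ⟨_, hρ.sub_mem g⟩)))
      rw [map_sub, map_smul, hφ0 _ hu, hφ0 _ hgu, smul_zero, sub_zero]
  rw [cogeneratedIdeal, characterIdeal, ← Ideal.span_eq J, ← Ideal.span_union,
    ← Ideal.span_union, Ideal.span_eq] at hf
  refine map_eq_zero_of_mem_span φ ?_ hf
  rintro a f ((hf | ⟨g, v, rfl⟩) | ⟨u, hu, rfl⟩)
  · exact hφJ _ (J.mul_mem_left _ hf)
  · rw [mono_mul_binomial, add_left_comm]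
    exact hφchar g (a + v)
  · rw [← mono_add]
    exact hφ0 _ fun h => hu (PrecedesMod.of_con h).of_add_left

namespace IsMonomialCharacter

variable (hρ : IsMonomialCharacter J x ρ) (hJ : IsBinomial J)
include hρ hJ

theorem mono_notMem_cogeneratedIdeal : mono k x ∉ cogeneratedIdeal J x ρ := by
  obtain ⟨φ, hφ, hφx, -⟩ := hρ.exists_functional hJ
  intro h
  exact one_ne_zero (hφx.symm.trans (hφ _ h))

theorem inducedCon_cogeneratedIdeal_iff {u : P.Loc} :
    inducedCon (cogeneratedIdeal J x ρ) u x ↔ inducedCon J u x := by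
  refine ⟨fun ⟨c, hc⟩ => by_contra fun hu => ?_, fun h => inducedCon_mono le_cogeneratedIdeal h⟩
  obtain ⟨φ, hφ, hφx, hφ0⟩ := hρ.exists_functional hJ
  have h := hφ _ hc
  rw [map_sub, map_smul, hφx, hφ0 u hu, zero_sub, smul_eq_mul, mul_one, neg_eq_zero] at h
  exact c.ne_zero h

theorem isCogeneratedBy : IsCogeneratedBy (cogeneratedIdeal J x ρ) x where
  mono_notMem := hρ.mono_notMem_cogeneratedIdeal hJ
  nonunit_add_mem u hu := by
    refine Ideal.mem_sup_right (Ideal.subset_span ⟨_, fun ⟨v, hv⟩ => hu ?_, rfl⟩)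
    rw [add_right_comm] at hv
    exact isAddUnit_of_add_isAddUnit_left (hρ.stabilizedByUnits _ hv)
  precedesMod y hy := by
    by_contra h
    exact hy (Ideal.mem_sup_right (Ideal.subset_span ⟨y, fun ⟨v, hv⟩ =>
      h ⟨v, (hρ.inducedCon_cogeneratedIdeal_iff hJ).2 hv⟩, rfl⟩))
  inducedCon_zero u hu := by
    obtain ⟨g, rfl⟩ := hρ.exists_coe_eq u ((hρ.inducedCon_cogeneratedIdeal_iff hJ).1 hu)
    exact ⟨ρ (Multiplicative.ofAdd g),
      characterIdeal_le_cogeneratedIdeal (Ideal.subset_span ⟨g, 0, by rw [add_zero]⟩)⟩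

theorem isMonomialCharacter_cogeneratedIdeal :
    IsMonomialCharacter (cogeneratedIdeal J x ρ) x ρ where
  mono_notMem := hρ.mono_notMem_cogeneratedIdeal hJ
  sub_mem g := le_cogeneratedIdeal (hρ.sub_mem g)
  exists_coe_eq u hu := hρ.exists_coe_eq u ((hρ.inducedCon_cogeneratedIdeal_iff hJ).1 hu)

theorem exists_isAddUnit_inducedCon {y : P.Loc}
    (hy : mono k y ∉ cogeneratedIdeal J x ρ)
    (hann : ∀ u, ¬ IsAddUnit u → mono k (u + y) ∈ cogeneratedIdeal J x ρ) :
    ∃ g, IsAddUnit g ∧ inducedCon J (g + y) x := by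
  obtain ⟨g, hg, h⟩ := (hρ.isCogeneratedBy hJ).exists_isAddUnit_inducedCon hy hann
  exact ⟨g, hg, (hρ.inducedCon_cogeneratedIdeal_iff hJ).1 h⟩

theorem colon_sup_eq_of_inducedCon {g y : P.Loc} (hg : IsAddUnit g)
    (hy : inducedCon J (g + y) x) : J.colon {mono k y} ⊔ primeMonomialIdeal k P =
      (cogeneratedIdeal J x ρ).colon {mono k y} ⊔ primeMonomialIdeal k P := by
  have hyW := (hρ.inducedCon_cogeneratedIdeal_iff hJ).2 hy
  rw [← colon_mono_add_eq (J := J) hg, colon_mono_eq_of_inducedCon hy, hρ.colon_sup_eq hJ,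
    ← colon_mono_add_eq (J := cogeneratedIdeal J x ρ) hg, colon_mono_eq_of_inducedCon hyW]
  exact ((hρ.isMonomialCharacter_cogeneratedIdeal hJ).colon_sup_eq
    (isBinomial_cogeneratedIdeal hJ)).symm

end IsMonomialCharacter

end CogeneratedIdeals

section Components

variable {k : Type*} [Field k] {Q : Type*} [AddCommMonoid Q] {P : MonoidPrime Q} {I : Ideal k[Q]}
  {w q : Q} {ρ : Multiplicative (stabilizer I P w) →* kˣ}

theorem map_cogeneratedMonomialIdeal : (cogeneratedMonomialIdeal I P w).map (locMap k P) =
    Ideal.span (mono k ''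
      {u | ¬ PrecedesMod (inducedCon (locIdeal I P)) u (P.toLoc w)}) := by
  rw [cogeneratedMonomialIdeal, Ideal.map_span]
  refine le_antisymm (Ideal.span_le.2 ?_) (Ideal.span_le.2 ?_)
  · rintro _ ⟨_, ⟨q, hq, rfl⟩, rfl⟩
    exact Ideal.subset_span ⟨P.toLoc q, mt mem_orderIdeal_iff.2 hq, (locMap_mono q).symm⟩
  · rintro _ ⟨u, hu, rfl⟩
    obtain ⟨g, hg, q, hq⟩ := P.exists_isAddUnit_add_eq_toLoc u
    rw [SetLike.mem_coe, ← mono_add_mem_iff hg, hq]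
    refine Ideal.subset_span ⟨_, ⟨q, fun h => hu ?_, rfl⟩, locMap_mono q⟩
    rwa [mem_orderIdeal_iff, ← hq, precedesMod_add_left_iff hg] at h

theorem component_eq_comap :
    component I P w ρ = (cogeneratedIdeal (locIdeal I P) (P.toLoc w) ρ).comap (locMap k P) := by
  rw [component, map_cogeneratedMonomialIdeal, cogeneratedIdeal]

theorem locIdeal_component : locIdeal (component I P w ρ) P =
    cogeneratedIdeal (locIdeal I P) (P.toLoc w) ρ := by
  rw [component_eq_comap, locIdeal_comap]

theorem le_component : I ≤ component I P w ρ := by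
  rw [component_eq_comap]
  exact Ideal.map_le_iff_le_comap.1 le_cogeneratedIdeal

theorem isCoprincipal_component [AddMonoid.FG Q] (hI : IsBinomial I) (hρ : IsCharacterAt I P w ρ) :
    IsCoprincipal (component I P w ρ) ∧ IsMesoprimaryFor (component I P w ρ) P := by
  have := isNoetherianRing_loc (k := k) P
  have hW := hρ.isMonomialCharacter.isCogeneratedBy (hI.locIdeal P)
  rw [component_eq_comap]
  have hmax := hW.isMaximalForCon (isBinomial_cogeneratedIdeal (hI.locIdeal P))
  exact ⟨⟨hmax, hW.isCoprincipalCon⟩, hmax, hW.isMesoprimaryConFor⟩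

theorem InMonomialSocle.mono_add_mem {J : Ideal k[Q]} (hq : InMonomialSocle J P q)
    {u : P.Loc} (hu : ¬ IsAddUnit u) : mono k (u + P.toLoc q) ∈ locIdeal J P := by
  obtain ⟨g, hg, p, hpP, hp⟩ := P.exists_mem_carrier_of_not_isAddUnit hu
  rw [← mono_add_mem_iff hg, ← add_assoc, hp, ← map_add]
  exact hq.2 p hpP

theorem IsCharacterAt.exists_isAddUnit_inducedCon (hρ : IsCharacterAt I P w ρ) (hI : IsBinomial I)
    (hq : InMonomialSocle (component I P w ρ) P q) :
    ∃ g, IsAddUnit g ∧ inducedCon (locIdeal I P) (g + P.toLoc q) (P.toLoc w) := by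
  refine hρ.isMonomialCharacter.exists_isAddUnit_inducedCon (hI.locIdeal P) ?_ fun u hu => ?_
  · exact locIdeal_component (ρ := ρ) ▸ hq.1
  · exact locIdeal_component (ρ := ρ) ▸ hq.mono_add_mem hu

theorem mesoprimeAt_component_eq (hI : IsBinomial I) (hρ : IsCharacterAt I P w ρ)
    (hq : InMonomialSocle (component I P w ρ) P q) :
    mesoprimeAt I P q = mesoprimeAt (component I P w ρ) P q := by
  obtain ⟨g, hg, h⟩ := hρ.exists_isAddUnit_inducedCon hI hq
  rw [mesoprimeAt, mesoprimeAt, localMesoprimeAt, localMesoprimeAt, locIdeal_component,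
    hρ.isMonomialCharacter.colon_sup_eq_of_inducedCon (hI.locIdeal P) hg h]

end Components

section Witnesses

variable {k : Type*} [Field k] {S : Type*} [AddCommMonoid S] {J : Ideal k[S]} {g : k[S]} {w x y : S}

theorem exists_minimal_precedesMod (c : AddCon S) {s : Finset S} (hs : s.Nonempty) :
    ∃ w ∈ s, ∀ v ∈ s, PrecedesMod c v w → PrecedesMod c w v := by
  let _ : Preorder S :=
    { le := PrecedesMod c
      le_refl := .refl c
      le_trans := fun _ _ _ => .trans }
  obtain ⟨w, hw⟩ := s.exists_minimal hs
  exact ⟨w, hw.1, fun v hv h => hw.2 hv h⟩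

theorem exists_isAddUnit_con_symm {c : AddCon S} {a : S} (ha : IsAddUnit a) (h : c (a + x) y) :
    ∃ a', IsAddUnit a' ∧ c (a' + y) x := by
  obtain ⟨a, rfl⟩ := ha
  refine ⟨(-a : AddUnits S), (-a).isAddUnit, ?_⟩
  rw [← con_add_left_iff c a.isAddUnit, ← add_assoc, AddUnits.add_neg, zero_add]
  exact c.symm h

theorem StabilizedByUnits.of_add_left {c : AddCon S} {a : S} (hy : StabilizedByUnits c y)
    (h : c (a + x) y) : StabilizedByUnits c x := by
  refine fun u hu => hy u ?_
  have hux : c (u + (a + x)) (a + x) := by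
    rw [add_left_comm]
    exact c.add (c.refl a) hu
  exact c.trans (c.add (c.refl u) (c.symm h)) (c.trans hux h)

/-- The ideal of the elements that the monomials of all nonunits multiply into `J`. -/
noncomputable def socleIdeal (J : Ideal k[S]) : Ideal k[S] :=
  J.colon (mono k '' {u | ¬ IsAddUnit u})

theorem mem_socleIdeal_iff {f : k[S]} :
    f ∈ socleIdeal J ↔ ∀ u, ¬ IsAddUnit u → mono k u * f ∈ J := by
  simp only [socleIdeal, Submodule.mem_colon, Set.forall_mem_image, Set.mem_ofPred_eq, smul_eq_mul,
    mul_comm f]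

theorem le_socleIdeal : J ≤ socleIdeal J :=
  fun _ hf => mem_socleIdeal_iff.2 fun _ _ => J.mul_mem_left _ hf

/-- The witness condition for an ideal of the algebra of a monoid whose nonunits form the relevant
prime. By `isWitness_iff` the `I`-witnesses for `P` are the witnesses of `I_P` in this sense. -/
structure IsMonomialWitness (J : Ideal k[S]) (x : S) : Prop where
  mono_notMem : mono k x ∉ J
  not_isNil : ¬ IsNil (x : (inducedCon J).Quotient)
  exists_inducedCon : ∀ u, ¬ IsAddUnit u →
    ∃ b, ¬ inducedCon J b x ∧ inducedCon J (u + b) (u + x)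

theorem IsMonomialWitness.of_isAddUnit_add {a : S} (hy : IsMonomialWitness J y) (ha : IsAddUnit a)
    (h : inducedCon J (a + x) y) : IsMonomialWitness J x where
  mono_notMem := by
    rw [← mono_add_mem_iff ha, mono_mem_iff_of_inducedCon h]
    exact hy.mono_notMem
  not_isNil hx := by
    have hxy : inducedCon J x y :=
      (inducedCon J).trans ((inducedCon J).symm ((isNil_coe_iff.1 hx).2 a)) h
    rw [(AddCon.eq _).2 hxy] at hx
    exact hy.not_isNil hx
  exists_inducedCon u hu := by
    obtain ⟨a', ha'⟩ := ha.exists_neg'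
    obtain ⟨b, hby, hub⟩ := hy.exists_inducedCon u hu
    refine ⟨a' + b, fun hb => hby ?_, ?_⟩
    · have := (inducedCon J).trans (inducedCon_add_left a hb) h
      rwa [← add_assoc, add_comm a, ha', zero_add] at this
    · have := inducedCon_add_left a' ((inducedCon J).trans hub
        (inducedCon_add_left u ((inducedCon J).symm h)))
      rwa [add_left_comm, add_left_comm a' u, ← add_assoc a', ha', zero_add] at this

theorem IsBinomial.exists_inducedCon_add (hJ : IsBinomial J) {u : S} (hw : w ∈ g.coeff.support)
    (hg : mono k u * g ∈ J) (huw : mono k (u + w) ∉ J) :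
    ∃ v ∈ g.coeff.support, v ≠ w ∧ inducedCon J (u + v) (u + w) := by
  by_contra! h
  rw [mono_mul_eq_mapDomainLinearMap] at hg
  exact hJ.mapDomainLinearMap_notMem (u + ·) hw huw (fun v hv => not_imp_not.1 (h v hv)) hg

theorem IsReduced.stabilizedByUnits_of_minimal (hg : IsReduced J g) (hJ : IsBinomial J)
    (hsoc : g ∈ socleIdeal J) (hw : w ∈ g.coeff.support)
    (hmin : ∀ v ∈ g.coeff.support, PrecedesMod (inducedCon J) v w →
      PrecedesMod (inducedCon J) w v) : StabilizedByUnits (inducedCon J) w := by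
  intro u hu
  by_contra hnu
  obtain ⟨v, hv, hne, hvw⟩ := hJ.exists_inducedCon_add hw (mem_socleIdeal_iff.1 hsoc u hnu)
    ((mono_mem_iff_of_inducedCon hu).not.2 (hg.mono_notMem w hw))
  have huv : inducedCon J (u + v) w := (inducedCon J).trans hvw hu
  obtain ⟨y, hy⟩ := hmin v hv ⟨u, by rwa [add_comm]⟩
  have huvv : inducedCon J (u + v) v := by
    refine (inducedCon J).trans (inducedCon_add_left u ((inducedCon J).symm hy)) ?_
    rw [← add_assoc]
    exact (inducedCon J).trans ((inducedCon J).add hu ((inducedCon J).refl y)) hy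
  exact hne (hg.eq_of_inducedCon v hv w hw ((inducedCon J).trans ((inducedCon J).symm huvv) huv))

theorem StabilizedByUnits.not_isNil {c : AddCon S} (hx : StabilizedByUnits c x) :
    ¬ IsNil (x : c.Quotient) := by
  rw [isNil_coe_iff]
  rintro ⟨⟨y, hy⟩, hnil⟩
  obtain ⟨x', hx'⟩ := (hx x (hnil x)).exists_neg'
  have := hnil (y + x')
  rw [add_assoc, hx', add_zero] at this
  exact hy this

theorem IsReduced.isMonomialWitness (hg : IsReduced J g) (hJ : IsBinomial J)
    (hsoc : g ∈ socleIdeal J) (hw : w ∈ g.coeff.support)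
    (hunits : StabilizedByUnits (inducedCon J) w) : IsMonomialWitness J w where
  mono_notMem := hg.mono_notMem w hw
  not_isNil := hunits.not_isNil
  exists_inducedCon u hu := by
    by_cases huw : mono k (u + w) ∈ J
    · exact ⟨u + w, fun h => hg.mono_notMem w hw ((mono_mem_iff_of_inducedCon h).1 huw),
        inducedCon_of_mono_mem (mono_add_mem u huw) huw⟩
    · obtain ⟨v, hv, hne, hvw⟩ := hJ.exists_inducedCon_add hw (mem_socleIdeal_iff.1 hsoc u hu) huw
      exact ⟨v, mt (hg.eq_of_inducedCon v hv w hw) hne, hvw⟩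

/- The coordinate along `t ^ w` is nonzero on `g`, hence on a monomial multiple of an element of
`T`; the monomial is that of a unit because `T` lies in the socle. -/
theorem IsReduced.exists_inducedCon_of_mem_span (hg : IsReduced J g) (hJ : IsBinomial J)
    (hw : w ∈ g.coeff.support) {T : Set k[S]} (hT : T ⊆ socleIdeal J) (hgT : g ∈ Ideal.span T) :
    ∃ e ∈ T, ∃ y ∈ e.coeff.support, ∃ a, IsAddUnit a ∧ inducedCon J (a + y) w := by
  obtain ⟨φ, hφJ, hφw, hφ⟩ := hJ.exists_functional (hg.mono_notMem w hw)
  have hφg : φ g ≠ 0 := by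
    rw [map_eq_of_forall_ne φ g w fun v hv hne => hφ v (mt (hg.eq_of_inducedCon v hv w hw) hne),
      hφw, smul_eq_mul, mul_one]
    exact Finsupp.mem_support_iff.1 hw
  contrapose! hφg
  refine map_eq_zero_of_mem_span φ (fun a e he => ?_) hgT
  by_cases ha : IsAddUnit a
  · by_contra hae
    obtain ⟨y, hy, hay⟩ := exists_map_mono_ne_zero (φ ∘ₗ LinearMap.mulLeft k (mono k a)) hae
    refine hay ?_
    rw [LinearMap.comp_apply, LinearMap.mulLeft_apply, ← mono_add]
    exact hφ _ (hφg e he y hy a ha)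
  · exact hφJ _ (mem_socleIdeal_iff.1 (hT he) a ha)

theorem IsBinomial.exists_isMonomialWitness (hJ : IsBinomial J) {T : Set k[S]}
    (hT : Ideal.span T = socleIdeal J) {f : k[S]} (hsoc : f ∈ socleIdeal J) (hf : f ∉ J) :
    ∃ g, f - g ∈ J ∧ IsReduced J g ∧ ∃ w ∈ g.coeff.support,
      StabilizedByUnits (inducedCon J) w ∧ IsMonomialWitness J w ∧
        ∃ e ∈ T, ∃ y ∈ e.coeff.support, ∃ a, IsAddUnit a ∧ inducedCon J (a + y) w := by
  obtain ⟨g, hfg, hred⟩ := exists_isReduced J f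
  replace hfg := binomialPart_le J hfg
  have hg : g ∈ socleIdeal J := (Submodule.sub_mem_iff_right _ hsoc).1 (le_socleIdeal hfg)
  have hne : g.coeff.support.Nonempty := by
    rw [Finsupp.support_nonempty_iff]
    rintro h
    rw [AddMonoidAlgebra.coeff_eq_zero.1 h, sub_zero] at hfg
    exact hf hfg
  obtain ⟨w, hw, hmin⟩ := exists_minimal_precedesMod (inducedCon J) hne
  have hunits := hred.stabilizedByUnits_of_minimal hJ hg hw hmin
  exact ⟨g, hfg, hred, w, hw, hunits, hred.isMonomialWitness hJ hg hw hunits,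
    hred.exists_inducedCon_of_mem_span hJ hw (hT ▸ Ideal.subset_span) (hT ▸ hg)⟩

end Witnesses

section LocalWitnesses

variable {k : Type*} [Field k] {Q : Type*} [AddCommMonoid Q] {P : MonoidPrime Q} {I : Ideal k[Q]}
  {J : Ideal k[P.Loc]}

theorem isWitness_iff {w : Q} : IsWitness I P w ↔ IsMonomialWitness (locIdeal I P) (P.toLoc w) := by
  have hcoe (q : Q) : toLocQuot (inducedCon I) P q = (P.toLoc q : LocQuot (inducedCon I) P) := rfl
  have hjoin (p : Q) : (∃ b, b ≠ toLocQuot (inducedCon I) P w ∧ toLocQuot (inducedCon I) P p + b =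
        toLocQuot (inducedCon I) P p + toLocQuot (inducedCon I) P w) ↔
      ∃ b, ¬ inducedCon (locIdeal I P) b (P.toLoc w) ∧
        inducedCon (locIdeal I P) (P.toLoc p + b) (P.toLoc p + P.toLoc w) := by
    simp only [hcoe, AddCon.mk'_surjective.exists, AddCon.coe_mk', ne_eq, ← AddCon.coe_add,
      coe_locQuot_eq_iff]
  have hnil : IsNil (toLocQuot (inducedCon I) P w) ↔
      IsNil (P.toLoc w : (inducedCon (locIdeal I P)).Quotient) := by
    rw [hcoe, isNil_coe_iff, isNil_coe_iff, locCon_inducedCon]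
  rw [IsWitness, hnil]
  simp only [hjoin]
  refine ⟨fun ⟨hw, hnil, hex⟩ => ⟨hw, hnil, fun u hu => ?_⟩, fun h =>
    ⟨h.mono_notMem, h.not_isNil, fun p hp => h.exists_inducedCon _ (P.not_isAddUnit_toLoc hp)⟩⟩
  obtain ⟨a, ha, p, hpP, hp⟩ := P.exists_mem_carrier_of_not_isAddUnit hu
  obtain ⟨b, hb, hpb⟩ := hex p hpP
  refine ⟨b, hb, ?_⟩
  rwa [← hp, add_assoc, add_assoc, con_add_left_iff _ ha] at hpb

theorem locMap_mem_socleIdeal {f : k[Q]} (hf : ∀ p ∈ P.carrier, mono k p * f ∈ I) :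
    locMap k P f ∈ socleIdeal (locIdeal I P) := by
  refine mem_socleIdeal_iff.2 fun u hu => ?_
  obtain ⟨a, ha, p, hpP, hp⟩ := P.exists_mem_carrier_of_not_isAddUnit hu
  rw [← mono_mul_mem_iff ha, ← mul_assoc, ← mono_add, hp, ← locMap_mono, ← map_mul]
  exact locMap_mem_locIdeal (hf p hpP)

theorem IsMonomialCharacter.notMem_cogeneratedIdeal {g : k[P.Loc]} {a w x : P.Loc}
    {K : AddSubgroup (AddUnits P.Loc)} {ρ : Multiplicative K →* kˣ}
    (hρ : IsMonomialCharacter J x ρ) (hJ : IsBinomial J) (hg : IsReduced J g)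
    (hw : w ∈ g.coeff.support) (ha : IsAddUnit a) (haw : inducedCon J (a + w) x) :
    g ∉ cogeneratedIdeal J x ρ := by
  have haw' := (hρ.inducedCon_cogeneratedIdeal_iff hJ).2 haw
  rw [← mono_mul_mem_iff ha, mono_mul_eq_mapDomainLinearMap]
  refine (isBinomial_cogeneratedIdeal hJ).mapDomainLinearMap_notMem (a + ·) hw ?_ fun v hv hvw => ?_
  · rw [mono_mem_iff_of_inducedCon haw']
    exact hρ.mono_notMem_cogeneratedIdeal hJ
  · have hav := (hρ.inducedCon_cogeneratedIdeal_iff hJ).1 ((inducedCon _).trans hvw haw')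
    refine hg.eq_of_inducedCon v hv w hw ((con_add_left_iff _ ha).1 ?_)
    exact (inducedCon J).trans hav ((inducedCon J).symm haw)

end LocalWitnesses

section Primes

variable {k : Type*} [Field k] {Q : Type*} [AddCommMonoid Q] {I : Ideal k[Q]}

namespace MonoidPrime

theorem ext_carrier {P P' : MonoidPrime Q} (h : P.carrier = P'.carrier) : P = P' := by
  cases P; cases P'; cases h; rfl

theorem add_mem_carrier_iff (P : MonoidPrime Q) {a b : Q} :
    a + b ∈ P.carrier ↔ a ∈ P.carrier ∨ b ∈ P.carrier :=
  ⟨P.mem_or_mem a b, fun h => h.elim (fun ha => P.add_mem a ha b)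
    fun hb => add_comm a b ▸ P.add_mem b hb a⟩

theorem finite [AddMonoid.FG Q] : Finite (MonoidPrime Q) := by
  obtain ⟨G, hG⟩ := AddMonoid.FG.fg_top (M := Q)
  refine Finite.of_injective
    (fun P : MonoidPrime Q => {g : G | (g : Q) ∈ P.carrier}) fun P P' h => ext_carrier ?_
  ext q
  have hq : q ∈ AddSubmonoid.closure (G : Set Q) := hG ▸ AddSubmonoid.mem_top q
  induction hq using AddSubmonoid.closure_induction with
  | mem g hg => exact Set.ext_iff.1 h ⟨g, hg⟩
  | zero => exact iff_of_false P.zero_notMem P'.zero_notMem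
  | add a b _ _ ha hb =>
    exact P.add_mem_carrier_iff.trans ((or_congr ha hb).trans P'.add_mem_carrier_iff.symm)

end MonoidPrime

theorem IsMesoprimaryConFor.unique {c : AddCon Q} {P P' : MonoidPrime Q}
    (h : IsMesoprimaryConFor c P) (h' : IsMesoprimaryConFor c P') : P = P' :=
  MonoidPrime.ext_carrier (h.2.trans h'.2.symm)

theorem exists_mono_mul_prime_annihilator [AddMonoid.FG Q] {f : k[Q]} (hf : f ∉ I) :
    ∃ x : Q, mono k x * f ∉ I ∧ ∀ a b : Q, mono k (a + b) * (mono k x * f) ∈ I →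
      mono k a * (mono k x * f) ∈ I ∨ mono k b * (mono k x * f) ∈ I := by
  have : IsNoetherianRing k[Q] := Algebra.FiniteType.isNoetherianRing k _
  obtain ⟨_, ⟨x, hx, rfl⟩, hmax⟩ := set_has_maximal_iff_noetherian.2 this
    {A | ∃ x : Q, mono k x * f ∉ I ∧ A = I.colon {mono k x * f}}
    ⟨_, 0, by rwa [mono_zero, one_mul], rfl⟩
  refine ⟨x, hx, fun a b hab => or_iff_not_imp_left.2 fun ha => ?_⟩
  have hle : I.colon {mono k x * f} ≤ I.colon {mono k (a + x) * f} := fun e he => by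
    rw [Submodule.mem_colon_singleton, smul_eq_mul] at he ⊢
    rw [mono_add, mul_assoc, mul_left_comm]
    exact I.mul_mem_left _ he
  have hax : mono k (a + x) * f ∉ I := by rwa [mono_add, mul_assoc]
  have hb : mono k b ∈ I.colon {mono k (a + x) * f} := by
    rwa [Submodule.mem_colon_singleton, smul_eq_mul, mono_add, mul_assoc, ← mul_assoc, ← mono_add,
      add_comm b]
  rw [← eq_of_le_of_not_lt hle (hmax _ ⟨a + x, hax, rfl⟩)] at hb
  exact Submodule.mem_colon_singleton.1 hb

theorem exists_monoidPrime_mem_socleIdeal [AddMonoid.FG Q] {f : k[Q]} (hf : f ∉ I) :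
    ∃ (P : MonoidPrime Q) (x : Q), locMap k P (mono k x * f) ∉ locIdeal I P ∧
      locMap k P (mono k x * f) ∈ socleIdeal (locIdeal I P) := by
  obtain ⟨x, hx, hprime⟩ := exists_mono_mul_prime_annihilator hf
  let P : MonoidPrime Q :=
    { carrier := {q | mono k q * (mono k x * f) ∈ I}
      zero_notMem := fun h => hx (by rwa [Set.mem_ofPred_eq, mono_zero, one_mul] at h)
      add_mem := fun p hp q => by
        rw [Set.mem_ofPred_eq, add_comm, mono_add, mul_assoc]
        exact I.mul_mem_left _ hp
      mem_or_mem := hprime }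
  refine ⟨P, x, fun h => ?_, locMap_mem_socleIdeal fun p hp => hp⟩
  obtain ⟨s, hs, h⟩ := locMap_mem_locIdeal_iff.1 h
  exact hs h

end Primes

section Decomposition

variable {k : Type*} [Field k] {Q : Type*} [AddCommMonoid Q] {I : Ideal k[Q]}

theorem exists_finite_cogenerators [AddMonoid.FG Q] (hI : IsBinomial I) (P : MonoidPrime Q) :
    ∃ s : Set Q, s.Finite ∧ ∀ f, locMap k P f ∈ socleIdeal (locIdeal I P) →
      locMap k P f ∉ locIdeal I P → ∃ w ∈ s, ∃ ρ : Multiplicative (stabilizer I P w) →* kˣ,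
        IsWitness I P w ∧ IsCharacterAt I P w ρ ∧ f ∉ component I P w ρ := by
  have hJ := hI.locIdeal P
  obtain ⟨T, hT⟩ := (isNoetherianRing_loc (k := k) P).noetherian (socleIdeal (locIdeal I P))
  choose b hb q hq using P.exists_isAddUnit_add_eq_toLoc
  refine ⟨⋃ e ∈ T, q '' e.coeff.support, T.finite_toSet.biUnion fun e _ =>
    e.coeff.support.finite_toSet.image q, fun f hsoc hf => ?_⟩
  obtain ⟨g, hfg, hred, w, hw, hunits, hwit, e, he, y, hy, a, ha, hay⟩ :=
    hJ.exists_isMonomialWitness hT hsoc hf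
  obtain ⟨a', ha', hwy⟩ := exists_isAddUnit_con_symm ha hay
  have hwq : inducedCon (locIdeal I P) (b y + a' + w) (P.toLoc (q y)) := by
    rw [← hq, add_assoc]
    exact inducedCon_add_left (b y) hwy
  obtain ⟨u, hu, hqw⟩ := exists_isAddUnit_con_symm ((hb y).add ha') hwq
  have hqJ := hwit.of_isAddUnit_add hu hqw
  obtain ⟨ρ, hρ, -⟩ :=
    existsUnique_isCharacterAt hI hqJ.mono_notMem (hunits.of_add_left hqw)
  refine ⟨q y, Set.mem_biUnion he ⟨y, hy, rfl⟩, ρ, isWitness_iff.2 hqJ, hρ, fun hmem => ?_⟩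
  rw [component_eq_comap, Ideal.mem_comap] at hmem
  refine hρ.isMonomialCharacter.notMem_cogeneratedIdeal hJ hred hw ((hb y).add ha') hwq ?_
  exact (Submodule.sub_mem_iff_right _ hmem).1 (le_cogeneratedIdeal hfg)

theorem exists_finite_components [AddMonoid.FG Q] (hI : IsBinomial I) :
    ∃ 𝒥 : Set (Ideal k[Q]), 𝒥.Finite ∧
      (∀ J ∈ 𝒥, ∃ P : MonoidPrime Q, IsCoprincipalComponent I P J) ∧ I = sInf 𝒥 := by
  have := MonoidPrime.finite (Q := Q)
  choose s hs hmem using exists_finite_cogenerators hI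
  refine ⟨⋃ P, ⋃ w ∈ s P, {J | ∃ ρ : Multiplicative (stabilizer I P w) →* kˣ,
    IsWitness I P w ∧ IsCharacterAt I P w ρ ∧ J = component I P w ρ}, ?_, ?_, ?_⟩
  · refine Set.finite_iUnion fun P => (hs P).biUnion fun w _ => Set.Subsingleton.finite ?_
    rintro _ ⟨ρ, -, hρ, rfl⟩ _ ⟨ρ', -, hρ', rfl⟩
    rw [hρ.isMonomialCharacter.eq hρ'.isMonomialCharacter]
  · simp only [Set.mem_iUnion]
    rintro _ ⟨P, w, -, ρ, hw, hρ, rfl⟩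
    exact ⟨P, w, ρ, hw, hρ, rfl⟩
  · refine le_antisymm (le_sInf ?_) fun f hf => ?_
    · simp only [Set.mem_iUnion]
      rintro _ ⟨P, w, -, ρ, -, -, rfl⟩
      exact le_component
    · by_contra hfI
      obtain ⟨P, x, hloc, hsoc⟩ := exists_monoidPrime_mem_socleIdeal hfI
      obtain ⟨w, hws, ρ, hw, hρ, hnot⟩ := hmem P _ hsoc hloc
      refine hnot (Ideal.mul_mem_left _ _ (Ideal.mem_sInf.1 hf ?_))
      simp only [Set.mem_iUnion]
      exact ⟨P, w, hws, ρ, hw, hρ, rfl⟩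

end Decomposition

end BinomialDecomposition

open BinomialDecomposition in
theorem theoremt {k : Type*} [Field k] {Q : Type*} [AddCommMonoid Q] [AddMonoid.FG Q]
    (I : Ideal (AddMonoidAlgebra k Q)) (hI : IsBinomial I) :
    -- every witness strictly below its translates by `P` has exactly one character
    (∀ (P : MonoidPrime Q) (w : Q), IsWitness I P w →
      (∀ p ∈ P.carrier, p + w ∉ orderIdeal (inducedCon I) P w) →
        ∃! ρ : Multiplicative (stabilizer I P w) →* kˣ, IsCharacterAt I P w ρ) ∧
    -- the components cogenerated by witnesses are coprincipal
    (∀ (P : MonoidPrime Q) (J : Ideal (AddMonoidAlgebra k Q)), IsCoprincipalComponent I P J →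
      IsCoprincipal J ∧ IsMesoprimaryFor J P) ∧
    -- their intersection is `I`
    I = sInf {J | ∃ P : MonoidPrime Q, IsCoprincipalComponent I P J} ∧
    -- finitely many of them form a combinatorial mesoprimary decomposition
    ∃ 𝒥 : Set (Ideal (AddMonoidAlgebra k Q)),
      (∀ J ∈ 𝒥, ∃ P : MonoidPrime Q, IsCoprincipalComponent I P J) ∧
        IsCombinatorialDecomposition I 𝒥 := by
  obtain ⟨𝒥, hfin, hcomp, hinf⟩ := exists_finite_components hI
  refine ⟨fun P w hw h => ?_, ?_, ?_, 𝒥, hcomp, ⟨hfin, hinf, fun J hJ => ?_, ?_⟩, ?_⟩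
  · exact existsUnique_isCharacterAt hI hw.1 (stabilizedByUnits_of_forall_notMem_orderIdeal h)
  · rintro P _ ⟨w, ρ, -, hρ, rfl⟩
    exact isCoprincipal_component hI hρ
  · refine le_antisymm (le_sInf ?_) ((sInf_le_sInf hcomp).trans_eq hinf.symm)
    rintro _ ⟨P, w, ρ, -, -, rfl⟩
    exact le_component
  · obtain ⟨P, w, ρ, -, hρ, rfl⟩ := hcomp J hJ
    have hmes := (isCoprincipal_component hI hρ).2
    exact ⟨hmes.1, hmes.2.1⟩
  · intro J hJ P' hP' q hq
    obtain ⟨P, w, ρ, -, hρ, rfl⟩ := hcomp J hJ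
    obtain rfl := hP'.2.unique (isCoprincipal_component hI hρ).2.2
    exact mesoprimeAt_component_eq hI hρ hq
  · intro J hJ P' hP' q hq
    obtain ⟨P, w, ρ, hw, hρ, rfl⟩ := hcomp J hJ
    obtain rfl := hP'.2.unique (isCoprincipal_component hI hρ).2.2
    obtain ⟨g, hg, hgq⟩ := hρ.exists_isAddUnit_inducedCon hI hq
    exact isWitness_iff.2 ((isWitness_iff.1 hw).of_isAddUnit_add hg hgq)
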